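/- **Definitions.** An *ETR instance* is a sentence $\exists x\in\mathbb{R}^N:\varphi(x)$, where $\varphi$ is a Boolean combination (using $\wedge,\vee,\neg$) of atomic predicates $p(x)=0$, $p(x)\neq 0$, $p(x)\ge 0$, $p(x)>0$ with $p\in\mathbb{Z}[x_1,\dots,x_N]$. Polynomials are written in sparse form, as lists of monomials with coefficients and exponent vectors in binary. ETR is the problem of deciding whether such a sentence is true. The class $\exists\mathbb{R}$ consists of the decision problems that are reducible to ETR by a polynomial-time many-one reduction (computed by a Turing machine from the encoded instance). For an integer $k\ge 1$, $\mathrm{ARM}(k)$ is the following decision problem. Input: $m,n,q\in\mathbb{N}$, matrices $A_1,\dots,A_q\in\mathbb{Q}^{m\times n}$ and scalars $b_1,\dots,b_q\in\mathbb{Q}$, with $m,n,q$ in binary and every rational given by numerator and denominator in reduced form in binary. Question: is there $X\in\mathbb{R}^{m\times n}$ with $\operatorname{rank}(X)\le k$ and $\langle A_\ell,X\rangle=b_\ell$ for all $\ell\in\{1,\dots,q\}$, where $\langle A,X\rangle=\sum_{i,j}A_{ij}X_{ij}$? **Theorem.** For every fixed $k\ge 1$, $\mathrm{ARM}(k)\in\exists\mathbb{R}$.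 Moreover, an instance $(A_\ell,b_\ell)_{\ell=1}^q$ of $\mathrm{ARM}(k)$ is a yes-instance if and only if $$\exists\,U\in\mathbb{R}^{m\times k}\ \exists\,V\in\mathbb{R}^{k\times n}:\ \bigwedge_{\ell=1}^q\bigl(\langle A_\ell,UV\rangle=b_\ell\bigr).$$ -/

import Mathlib

/-! ### Alphabet and prefix-free binary encodings -/

/-- The finite alphabet in which problem instances are written. -/
inductive Token : Type
  | bit (b : Bool)
  | minus
  | slash
  | endNum
  | matrix
  | row
  | rhs
  | ex
  | monomial
  | endPoly
  | eqZero
  | neZero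
  | geZero
  | gtZero
  | conj
  | disj
  | neg
  deriving DecidableEq, Fintype

/-- Each code word can be split off uniquely from the front of a string. -/
def PrefixInj {α : Type} (e : α → List Token) : Prop :=
  ∀ a b s t, e a ++ s = e b ++ t → a = b ∧ s = t

theorem PrefixInj.injective {α : Type} {e : α → List Token} (h : PrefixInj e) :
    Function.Injective e := fun a b hab => (h a b [] [] (by rw [hab])).1

/-- The binary digits of a natural number (least significant digit first). -/
def bitsNat (n : ℕ) : List Token := (Computability.encodeNat n).map Token.bit

theorem bitsNat_split (c : Token) (hc : ∀ b, c ≠ Token.bit b) (m n : ℕ) (s t : List Token)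
    (h : bitsNat m ++ c :: s = bitsNat n ++ c :: t) : m = n ∧ s = t := by
  have key : ∀ (u v : List Bool), u.map Token.bit ++ c :: s = v.map Token.bit ++ c :: t →
      u = v ∧ s = t := by
    intro u
    induction u with
    | nil =>
      intro v hv
      cases v with
      | nil => simpa using hv
      | cons b v => simp at hv; exact absurd hv.1 (hc b)
    | cons a u ih =>
      intro v hv
      cases v with
      | nil => simp at hv; exact absurd hv.1.symm (hc a)
      | cons b v =>
        simp only [List.map_cons, List.cons_append, List.cons.injEq, Token.bit.injEq] at hv
        obtain ⟨h1, h2⟩ := ih v hv.2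
        exact ⟨by rw [hv.1, h1], h2⟩
  obtain ⟨h1, h2⟩ := key _ _ h
  refine ⟨?_, h2⟩
  rw [← Computability.decode_encodeNat m, h1, Computability.decode_encodeNat]

/-- A natural number in binary, closed by an end marker. -/
def encNat (n : ℕ) : List Token := bitsNat n ++ [Token.endNum]

theorem prefixInj_encNat : PrefixInj encNat := by
  intro m n s t h
  simp only [encNat, List.append_assoc, List.singleton_append] at h
  exact bitsNat_split _ (by simp) _ _ _ _ h

/-- The sign of an integer, written only in front of negative numbers. -/
def encSign (z : ℤ) : List Token := if z < 0 then [Token.minus] else []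

theorem bitsNat_no_minus (c : Token) (hc : c ≠ Token.minus) (n : ℕ) (s t : List Token) :
    Token.minus :: s ≠ bitsNat n ++ c :: t := by
  unfold bitsNat
  cases Computability.encodeNat n with
  | nil => simpa using fun h => absurd h.symm hc
  | cons b l => simp

theorem encSign_split (c : Token) (hc : ∀ b, c ≠ Token.bit b) (hc' : c ≠ Token.minus)
    (y z : ℤ) (s t : List Token)
    (h : encSign y ++ (bitsNat y.natAbs ++ c :: s) = encSign z ++ (bitsNat z.natAbs ++ c :: t)) :
    y = z ∧ s = t := by
  unfold encSign at h
  split_ifs at h with h1 h2 h2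
  · simp only [List.singleton_append, List.cons.injEq, true_and] at h
    obtain ⟨h3, h4⟩ := bitsNat_split c hc _ _ _ _ h
    exact ⟨by omega, h4⟩
  · exact absurd h (bitsNat_no_minus c hc' _ _ _)
  · exact absurd h.symm (bitsNat_no_minus c hc' _ _ _)
  · simp only [List.nil_append] at h
    obtain ⟨h3, h4⟩ := bitsNat_split c hc _ _ _ _ h
    exact ⟨by omega, h4⟩

/-- An integer: sign and binary digits of the absolute value. -/
def encInt (z : ℤ) : List Token := encSign z ++ bitsNat z.natAbs ++ [Token.endNum]

theorem prefixInj_encInt : PrefixInj encInt := by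
  intro y z s t h
  simp only [encInt, List.append_assoc, List.singleton_append] at h
  exact encSign_split _ (by simp) (by simp) _ _ _ _ h

/-- A rational number in reduced form: sign, numerator and denominator in binary. -/
def encRat (r : ℚ) : List Token :=
  encSign r.num ++ bitsNat r.num.natAbs ++ [Token.slash] ++ bitsNat r.den ++ [Token.endNum]

theorem prefixInj_encRat : PrefixInj encRat := by
  intro r r' s t h
  simp only [encRat, List.append_assoc, List.singleton_append] at h
  obtain ⟨h1, h2⟩ := encSign_split _ (by simp) (by simp) _ _ _ _ h
  obtain ⟨h3, h4⟩ := bitsNat_split _ (by simp) _ _ _ _ h2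
  exact ⟨Rat.ext h1 h3, h4⟩

/-- A finite family of known length, written entry after entry. -/
def encFin {α : Type} (e : α → List Token) {n : ℕ} (f : Fin n → α) : List Token :=
  (List.ofFn f).flatMap e

theorem prefixInj_encFin {α : Type} {e : α → List Token} (he : PrefixInj e) (n : ℕ) :
    PrefixInj (encFin e (n := n)) := by
  induction n with
  | zero =>
    intro f g s t h
    exact ⟨Subsingleton.elim _ _, by simpa [encFin] using h⟩
  | succ n ih =>
    intro f g s t h
    simp only [encFin, List.ofFn_succ, List.flatMap_cons, List.append_assoc] at h
    obtain ⟨h1, h2⟩ := he _ _ _ _ h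
    obtain ⟨h3, h4⟩ := ih _ _ _ _ h2
    refine ⟨funext fun i => ?_, h4⟩
    refine Fin.cases h1 (fun j => congrFun h3 j) i

/-! ### Decision problems and polynomial-time many-one reductions -/

/-- A decision problem: a type of instances, each written as a string over a finite alphabet
(distinct instances being written differently), and the set of yes-instances. -/
structure DecisionProblem where
  /-- the instances -/
  Inst : Type
  /-- the alphabet -/
  Alphabet : Type
  /-- the alphabet is finite -/
  finite_alphabet : Finite Alphabet
  /-- the encoding of instances as strings -/
  encode : Inst → List Alphabet
  /-- the encoding is unambiguous -/
  encode_injective : Function.Injective encode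
  /-- the yes-instances -/
  Yes : Inst → Prop

/-- Polynomial-time many-one reducibility; the reduction is computed by a multi-stack Turing machine
whose number of steps is bounded by a polynomial in the length of the encoded input. -/
def PolyTimeReducible (P Q : DecisionProblem) : Prop :=
  ∃ f : P.Inst → Q.Inst,
    Nonempty (Turing.TM2ComputableInPolyTime P.encode Q.encode f) ∧
      ∀ x : P.Inst, P.Yes x ↔ Q.Yes (f x)

/-! ### The existential theory of the reals -/

/-- An integer polynomial in `N` variables in sparse form: a list of monomials, each given by
its coefficient and its exponent vector. -/
abbrev SparsePoly (N : ℕ) : Type := List (ℤ × (Fin N → ℕ))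

/-- The value of a sparse polynomial at a real point. -/
def SparsePoly.eval {N : ℕ} (p : SparsePoly N) (x : Fin N → ℝ) : ℝ :=
  (p.map fun c => (c.1 : ℝ) * ∏ i, x i ^ c.2 i).sum

/-- The polynomial of `ℤ[x₁, …, x_N]` that a sparse list represents. -/
noncomputable def SparsePoly.toMvPolynomial {N : ℕ} (p : SparsePoly N) :
    MvPolynomial (Fin N) ℤ :=
  (p.map fun c => MvPolynomial.monomial (Finsupp.equivFunOnFinite.symm c.2) c.1).sum

/-- The value of a sparse polynomial is the value of the polynomial that it represents. -/
theorem SparsePoly.aeval_toMvPolynomial {N : ℕ} (p : SparsePoly N) (x : Fin N → ℝ) :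
    MvPolynomial.aeval x p.toMvPolynomial = p.eval x := by
  induction p with
  | nil => simp [SparsePoly.toMvPolynomial, SparsePoly.eval]
  | cons c p ih =>
    simp only [SparsePoly.toMvPolynomial, SparsePoly.eval] at ih ⊢
    simp only [List.map_cons, List.sum_cons, map_add, ih]
    rw [MvPolynomial.aeval_monomial, Finsupp.prod_fintype _ _ (by simp)]
    simp

/-- The four kinds of atomic predicates `p = 0`, `p ≠ 0`, `p ≥ 0`, `p > 0`. -/
inductive AtomKind : Type
  | eqZero
  | neZero
  | geZero
  | gtZero

/-- The meaning of an atomic predicate for a given value of its polynomial. -/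
def AtomKind.Holds : AtomKind → ℝ → Prop
  | .eqZero, v => v = 0
  | .neZero, v => v ≠ 0
  | .geZero, v => 0 ≤ v
  | .gtZero, v => 0 < v

/-- The symbol of an atomic predicate. -/
def AtomKind.sym : AtomKind → Token
  | .eqZero => .eqZero
  | .neZero => .neZero
  | .geZero => .geZero
  | .gtZero => .gtZero

/-- Quantifier-free formulas in `N` real variables. -/
inductive QFFormula (N : ℕ) : Type
  | atom (r : AtomKind) (p : SparsePoly N)
  | conj (φ ψ : QFFormula N)
  | disj (φ ψ : QFFormula N)
  | neg (φ : QFFormula N)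

/-- Satisfaction of a quantifier-free formula at a real point. -/
def QFFormula.Sat {N : ℕ} : QFFormula N → (Fin N → ℝ) → Prop
  | .atom r p, x => r.Holds (p.eval x)
  | .conj φ ψ, x => φ.Sat x ∧ ψ.Sat x
  | .disj φ ψ, x => φ.Sat x ∨ ψ.Sat x
  | .neg φ, x => ¬ φ.Sat x

/-- A monomial: its coefficient and its exponent vector, all numbers in binary. -/
def encMonomial {N : ℕ} (c : ℤ × (Fin N → ℕ)) : List Token :=
  encInt c.1 ++ encFin encNat c.2

theorem prefixInj_encMonomial (N : ℕ) : PrefixInj (encMonomial (N := N)) := by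
  intro c d s t h
  simp only [encMonomial, List.append_assoc] at h
  obtain ⟨h1, h2⟩ := prefixInj_encInt _ _ _ _ h
  obtain ⟨h3, h4⟩ := prefixInj_encFin prefixInj_encNat N _ _ _ _ h2
  exact ⟨Prod.ext h1 h3, h4⟩

/-- A sparse polynomial: the list of its monomials. -/
def encPoly {N : ℕ} (p : SparsePoly N) : List Token :=
  (p.flatMap fun c => Token.monomial :: encMonomial c) ++ [Token.endPoly]

theorem prefixInj_encPoly (N : ℕ) : PrefixInj (encPoly (N := N)) := by
  intro p
  induction p with
  | nil =>
    intro p' s t h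
    cases p' with
    | nil => simpa [encPoly] using h
    | cons d p' => simp [encPoly] at h
  | cons c p ih =>
    intro p' s t h
    cases p' with
    | nil => simp [encPoly] at h
    | cons d p' =>
      simp only [encPoly, List.flatMap_cons, List.cons_append, List.append_assoc,
        List.cons.injEq, true_and] at h
      obtain ⟨h1, h2⟩ := prefixInj_encMonomial N _ _ _ _ h
      obtain ⟨h3, h4⟩ := ih p' s t (by simpa [encPoly] using h2)
      exact ⟨by rw [h1, h3], h4⟩

/-- A quantifier-free formula, in prefix notation. -/
def QFFormula.encode {N : ℕ} : QFFormula N → List Token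
  | .atom r p => r.sym :: encPoly p
  | .conj φ ψ => Token.conj :: (φ.encode ++ ψ.encode)
  | .disj φ ψ => Token.disj :: (φ.encode ++ ψ.encode)
  | .neg φ => Token.neg :: φ.encode

theorem prefixInj_encodeFormula (N : ℕ) : PrefixInj (QFFormula.encode (N := N)) := by
  intro φ
  induction φ with
  | atom r p =>
    intro φ' s t h
    cases φ' with
    | atom r' p' =>
      simp only [QFFormula.encode, List.cons_append, List.cons.injEq] at h
      obtain ⟨h1, h2⟩ := prefixInj_encPoly N _ _ _ _ h.2
      have h3 : r = r' := by
        have h4 := h.1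
        cases r <;> cases r' <;> simp [AtomKind.sym] at h4 ⊢
      exact ⟨by rw [h1, h3], h2⟩
    | conj _ _ => cases r <;> simp [QFFormula.encode, AtomKind.sym] at h
    | disj _ _ => cases r <;> simp [QFFormula.encode, AtomKind.sym] at h
    | neg _ => cases r <;> simp [QFFormula.encode, AtomKind.sym] at h
  | conj φ ψ ih1 ih2 =>
    intro φ' s t h
    cases φ' with
    | atom r' _ => cases r' <;> simp [QFFormula.encode, AtomKind.sym] at h
    | conj φ' ψ' =>
      simp only [QFFormula.encode, List.cons_append, List.append_assoc, List.cons.injEq,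
        true_and] at h
      obtain ⟨h1, h2⟩ := ih1 _ _ _ h
      obtain ⟨h3, h4⟩ := ih2 _ _ _ h2
      exact ⟨by rw [h1, h3], h4⟩
    | disj _ _ => simp [QFFormula.encode] at h
    | neg _ => simp [QFFormula.encode] at h
  | disj φ ψ ih1 ih2 =>
    intro φ' s t h
    cases φ' with
    | atom r' _ => cases r' <;> simp [QFFormula.encode, AtomKind.sym] at h
    | disj φ' ψ' =>
      simp only [QFFormula.encode, List.cons_append, List.append_assoc, List.cons.injEq,
        true_and] at h
      obtain ⟨h1, h2⟩ := ih1 _ _ _ h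
      obtain ⟨h3, h4⟩ := ih2 _ _ _ h2
      exact ⟨by rw [h1, h3], h4⟩
    | conj _ _ => simp [QFFormula.encode] at h
    | neg _ => simp [QFFormula.encode] at h
  | neg φ ih =>
    intro φ' s t h
    cases φ' with
    | atom r' _ => cases r' <;> simp [QFFormula.encode, AtomKind.sym] at h
    | neg φ' =>
      simp only [QFFormula.encode, List.cons_append, List.cons.injEq, true_and] at h
      obtain ⟨h1, h2⟩ := ih _ _ _ h
      exact ⟨by rw [h1], h2⟩
    | conj _ _ => simp [QFFormula.encode] at h
    | disj _ _ => simp [QFFormula.encode] at h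

/-- A sentence `∃ x ∈ ℝᴺ, φ(x)` with quantifier-free `φ`. -/
structure ETRSentence : Type where
  /-- the number of variables -/
  N : ℕ
  /-- the quantifier-free part -/
  φ : QFFormula N

/-- Truth of an existential sentence over the reals. -/
def ETRSentence.IsTrue (S : ETRSentence) : Prop := ∃ x : Fin S.N → ℝ, S.φ.Sat x

/-- A sentence: one quantifier symbol for each variable, then the formula. -/
def ETRSentence.encode (S : ETRSentence) : List Token :=
  List.replicate S.N Token.ex ++ S.φ.encode

theorem QFFormula.encode_no_ex {N : ℕ} (φ : QFFormula N) (s : List Token) :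
    φ.encode ≠ Token.ex :: s := by
  cases φ with
  | atom r p => cases r <;> simp [QFFormula.encode, AtomKind.sym]
  | conj _ _ => simp [QFFormula.encode]
  | disj _ _ => simp [QFFormula.encode]
  | neg _ => simp [QFFormula.encode]

theorem ETRSentence.encode_injective : Function.Injective ETRSentence.encode := by
  have key : ∀ (M N : ℕ) (u v : List Token), (∀ s, u ≠ Token.ex :: s) → (∀ s, v ≠ Token.ex :: s) →
      List.replicate M Token.ex ++ u = List.replicate N Token.ex ++ v → M = N ∧ u = v := by
    intro M
    induction M with
    | zero =>
      intro N u v hu hv h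
      cases N with
      | zero => simpa using h
      | succ N => exact absurd (by simpa [List.replicate_succ] using h) (hu _)
    | succ M ih =>
      intro N u v hu hv h
      cases N with
      | zero => exact absurd (by simpa [List.replicate_succ] using h.symm) (hv _)
      | succ N =>
        simp only [List.replicate_succ, List.cons_append, List.cons.injEq, true_and] at h
        obtain ⟨h1, h2⟩ := ih N u v hu hv h
        exact ⟨by rw [h1], h2⟩
  rintro ⟨M, φ⟩ ⟨N, ψ⟩ h
  obtain ⟨h1, h2⟩ := key M N _ _ φ.encode_no_ex ψ.encode_no_ex h
  subst h1
  rw [(prefixInj_encodeFormula M).injective h2]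

/-- The decision problem ETR. -/
def ETR : DecisionProblem where
  Inst := ETRSentence
  Alphabet := Token
  finite_alphabet := inferInstance
  encode := ETRSentence.encode
  encode_injective := ETRSentence.encode_injective
  Yes := ETRSentence.IsTrue

/-- The complexity class `∃ℝ`: the decision problems that are polynomial-time many-one reducible
to ETR. -/
def ExistsR : Set DecisionProblem := {P | PolyTimeReducible P ETR}

/-! ### Affine rank minimization -/

/-- The Frobenius inner product of a rational matrix with a real matrix. -/
def frobeniusInner {m n : ℕ} (A : Matrix (Fin m) (Fin n) ℚ) (X : Matrix (Fin m) (Fin n) ℝ) : ℝ :=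
  ∑ i, ∑ j, (A i j : ℝ) * X i j

/-- The input of affine rank minimization. -/
structure ARMInstance : Type where
  /-- the number of rows -/
  m : ℕ
  /-- the number of columns -/
  n : ℕ
  /-- the number of affine constraints -/
  q : ℕ
  /-- the constraint matrices -/
  A : Fin q → Matrix (Fin m) (Fin n) ℚ
  /-- the right-hand sides -/
  b : Fin q → ℚ

/-- Some real matrix of rank at most `k` satisfies all the affine constraints. -/
def ARMInstance.Feasible (k : ℕ) (I : ARMInstance) : Prop :=
  ∃ X : Matrix (Fin I.m) (Fin I.n) ℝ, (∀ l, frobeniusInner (I.A l) X = I.b l) ∧ X.rank ≤ k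

/-- A row of a constraint matrix. -/
def encRow {n : ℕ} (r : Fin n → ℚ) : List Token := Token.row :: encFin encRat r

/-- One affine constraint: the matrix, row by row, and the right-hand side. -/
def encConstraint {m n : ℕ} (c : (Fin m → Fin n → ℚ) × ℚ) : List Token :=
  Token.matrix :: (encFin encRow c.1 ++ Token.rhs :: encRat c.2)

theorem prefixInj_encRow (n : ℕ) : PrefixInj (encRow (n := n)) := by
  intro r r' s t h
  simp only [encRow, List.cons_append, List.cons.injEq, true_and] at h
  exact prefixInj_encFin prefixInj_encRat n _ _ _ _ h

theorem prefixInj_encConstraint (m n : ℕ) : PrefixInj (encConstraint (m := m) (n := n)) := by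
  intro c d s t h
  simp only [encConstraint, List.cons_append, List.append_assoc, List.cons.injEq,
    true_and] at h
  obtain ⟨h1, h2⟩ := prefixInj_encFin (prefixInj_encRow n) m _ _ _ _ h
  simp only [List.cons.injEq, true_and] at h2
  obtain ⟨h3, h4⟩ := prefixInj_encRat _ _ _ _ h2
  exact ⟨Prod.ext h1 h3, h4⟩

/-- An instance: `m`, `n`, `q` in binary, then the `q` affine constraints. -/
def ARMInstance.encode (I : ARMInstance) : List Token :=
  encNat I.m ++ encNat I.n ++ encNat I.q ++
    encFin encConstraint fun l => ((fun i j => I.A l i j), I.b l)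

theorem ARMInstance.encode_injective : Function.Injective ARMInstance.encode := by
  rintro ⟨m, n, q, A, b⟩ ⟨m', n', q', A', b'⟩ h
  simp only [ARMInstance.encode, List.append_assoc] at h
  obtain ⟨h1, h2⟩ := prefixInj_encNat _ _ _ _ h
  obtain ⟨h3, h4⟩ := prefixInj_encNat _ _ _ _ h2
  obtain ⟨h5, h6⟩ := prefixInj_encNat _ _ _ _ h4
  subst h1 h3 h5
  have h7 := (prefixInj_encFin (prefixInj_encConstraint m n) q).injective h6
  have hA : A = A' := funext fun l => congrArg Prod.fst (congrFun h7 l)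
  have hb : b = b' := funext fun l => congrArg Prod.snd (congrFun h7 l)
  rw [hA, hb]

/-- The decision problem `ARM(k)`. -/
def ARM (k : ℕ) : DecisionProblem where
  Inst := ARMInstance
  Alphabet := Token
  finite_alphabet := inferInstance
  encode := ARMInstance.encode
  encode_injective := ARMInstance.encode_injective
  Yes := ARMInstance.Feasible k

/-! ### Commands for writing exponent vectors -/

/-! A matrix has rank at most `k` exactly when it factors through a `k`-dimensional space
(`Matrix.rank_le_iff_exists_mul`), so the unknown `X` may be replaced by `U * V`. This is the second
claim, and it turns an instance into a system of polynomial equations.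

For membership in `∃ℝ` a Turing machine must write such a system in polynomial time. Three devices
keep the machine simple.

Denominators are never cleared. The rational number `r` with index `p` gets its own variable `R_p`
and the equation `num + den * R_p = 0`, so `R_p = -r` and the digits are merely copied. A constraint
becomes `∑ R_p * U_it * V_tj - R_p' = 0`, with coefficients `1` and `-1`.

The binary numbers `m`, `n`, `q` are never decoded. If the input has length `L`, the sentence has
`L` cells of `2k + 1` variables; cell `x` holds the `U` variables of one row, the `V` variables of
one column and one `R`. This suffices because a single constraint already spells out all its entries
(`length_encode_ge`, `index_lt_length`). Without constraints `m` and `n` may be exponentially large,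
but then no variable is used and both questions have the answer yes.

Exponent vectors are written with a ruler of `L` cells on which the counters for row, column and
rational are marked. One sweep over the ruler writes a vector or moves a counter. The equations of
the rationals and those of the constraints arise in the same pass, hence the two output lists.

The machine follows an abstract run (`within_reduction`) whose output has polynomial length
(`length_reductionText_le`). This output is the encoding of `ARMInstance.toETR` (`encode_toETR`),
and that sentence is true exactly for feasible instances (`isTrue_toETR_iff`). -/

/-- The counters of the reduction: the row, the column and the number of rationals read so far. -/
inductive Ptr : Type
  | row
  | col
  | pos
  deriving DecidableEq

instance : Fintype Ptr := ⟨{.row, .col, .pos}, fun a => by cases a <;> simp⟩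

/-- A cell of the ruler records which counters point to it. -/
abbrev Cell : Type := Ptr → Bool

/-- The power products that the reduction writes: `1`, `R_p` and `R_p * U_it * V_tj`. -/
inductive PowerProduct (k : ℕ) : Type
  | one
  | rat
  | prod (t : Fin k)
  deriving DecidableEq, Fintype

/-- The slot of `U_it` among the variables of a cell. -/
def slotU {k : ℕ} (t : Fin k) : Fin (k + k + 1) := ⟨t, by omega⟩

/-- The slot of `V_tj` among the variables of a cell. -/
def slotV {k : ℕ} (t : Fin k) : Fin (k + k + 1) := ⟨k + t, by omega⟩

/-- The slot of `R_p` among the variables of a cell. -/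
def slotR (k : ℕ) : Fin (k + k + 1) := Fin.last (k + k)

/-- The variables of a power product, each given by a counter and a slot. -/
def PowerProduct.factors {k : ℕ} : PowerProduct k → List (Ptr × Fin (k + k + 1))
  | .one => []
  | .rat => [(.pos, slotR k)]
  | .prod t => [(.row, slotU t), (.col, slotV t), (.pos, slotR k)]

/-- The exponents of a power product in the variables of one cell. -/
def PowerProduct.cellExponent {k : ℕ} (e : PowerProduct k) (x : Cell) (s : Fin (k + k + 1)) : ℕ :=
  (e.factors.map fun g => if x g.1 = true ∧ s = g.2 then 1 else 0).sum

/-- Commands of the reduction. The flag chooses one of the two output lists. -/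
inductive Cmd (k : ℕ) : Type
  | put (b : Bool) (t : Token)
  | ex
  | vec (b : Bool) (e : PowerProduct k)
  | inc (a : Ptr)
  | reset (a : Ptr)
  deriving DecidableEq, Fintype

/-- The output list to which a command appends. -/
def Cmd.target {k : ℕ} : Cmd k → Bool
  | .put b _ => b
  | .vec b _ => b
  | _ => false

/-- The string that a command writes for one cell of the ruler. -/
def Cmd.cellOut {k : ℕ} : Cmd k → Cell → List Token
  | .ex, _ => List.replicate (k + k + 1) Token.ex
  | .vec _ e, x => encFin encNat (e.cellExponent x)
  | _, _ => []

/-- The effect of a command on the counters. -/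
def Cmd.movePtr {k : ℕ} : Cmd k → (Ptr → ℕ) → Ptr → ℕ
  | .inc a, ptr => Function.update ptr a (ptr a + 1)
  | .reset a, ptr => Function.update ptr a 0
  | _, ptr => ptr

/-- The cell number `x` of the ruler. -/
def cellAt (ptr : Ptr → ℕ) (x : ℕ) : Cell := fun a => decide (x = ptr a)

/-- How far the reading of the input has come; the flag is set on the right-hand side of
a constraint. -/
inductive Mode : Type
  | header (h : Fin 3)
  | fresh (r : Bool)
  | num (r : Bool)
  | den (r : Bool)
  deriving DecidableEq, Fintype

/-- The commands that write the monomials `R_p * U_it * V_tj`, `t < k`. -/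
def prodCmds (k : ℕ) : List (Cmd k) :=
  (List.finRange k).flatMap fun t =>
    [.put true .monomial, .put true (.bit true), .put true .endNum, .vec true (.prod t)]

/-- The commands at the beginning of a numerator. -/
def openCmds (k : ℕ) : List (Cmd k) :=
  [.put false .conj, .put false .eqZero, .put false .monomial]

/-- The commands at the end of a numerator. -/
def slashCmds (k : ℕ) : List (Cmd k) :=
  [.put false .endNum, .vec false .one, .put false .monomial]

/-- The commands at the end of a rational number. -/
def endCmds (k : ℕ) : Bool → List (Cmd k)
  | false => [.put false .endNum, .vec false .rat, .put false .endPoly] ++ prodCmds k ++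
      [.inc .col, .inc .pos]
  | true => [.put false .endNum, .vec false .rat, .put false .endPoly, .put true .monomial,
      .put true .minus, .put true (.bit true), .put true .endNum, .vec true .rat,
      .put true .endPoly, .inc .pos]

/-- The transducer that turns an instance of affine rank minimization into commands. -/
def transduce (k : ℕ) : Mode → Token → Mode × List (Cmd k)
  | .header 0, .endNum => (.header 1, [])
  | .header 1, .endNum => (.header 2, [])
  | .header 2, .endNum => (.fresh false, [])
  -- The counter `pos` is not reset: rationals are numbered through all constraints. Rows are
  -- counted by the markers in front of them, so they occupy the cells 1 to `m`, whereas columns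
  -- start with cell 0.
  | .fresh _, .matrix => (.fresh false, [.put true .conj, .put true .eqZero, .reset .row])
  | .fresh r, .row => (.fresh r, [.inc .row, .reset .col])
  | .fresh _, .rhs => (.fresh true, [])
  | .fresh r, .minus => (.num r, openCmds k ++ [.put false .minus])
  | .fresh r, .bit b => (.num r, openCmds k ++ [.put false (.bit b)])
  -- Zero has no binary digits, so the numerator 0 shows up as a bare slash.
  | .fresh r, .slash => (.den r, openCmds k ++ slashCmds k)
  | .num r, .bit b => (.num r, [.put false (.bit b)])
  | .num r, .slash => (.den r, slashCmds k)
  | .den r, .bit b => (.den r, [.put false (.bit b)])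
  | .den r, .endNum => (.fresh r, endCmds k r)
  -- In particular the digits of `m`, `n` and `q` are skipped.
  | m, _ => (m, [])

/-- The commands before the first token: one quantifier symbol for each variable. -/
def startCmds (k : ℕ) : List (Cmd k) := [.reset .pos, .ex]

/-! ### The abstract run -/

/-- The counters and the two output lists. -/
structure Work : Type where
  /-- the counters -/
  ptr : Ptr → ℕ
  /-- the output lists -/
  out : Bool → List Token

/-- The string that a command writes. -/
def Cmd.text {k : ℕ} (L : ℕ) (ptr : Ptr → ℕ) : Cmd k → List Token
  | .put _ t => [t]
  | c => (List.range L).flatMap fun x => c.cellOut (cellAt ptr x)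

/-- Execution of a command. -/
def Cmd.exec {k : ℕ} (L : ℕ) (w : Work) (c : Cmd k) : Work where
  ptr := c.movePtr w.ptr
  out := Function.update w.out c.target (w.out c.target ++ c.text L w.ptr)

/-- Execution of a list of commands. -/
def execAll {k : ℕ} (L : ℕ) (w : Work) (cs : List (Cmd k)) : Work := cs.foldl (Cmd.exec L) w

/-- Reading one token. -/
def readToken (k L : ℕ) (s : Mode × Work) (t : Token) : Mode × Work :=
  ((transduce k s.1 t).1, execAll L s.2 (transduce k s.1 t).2)

/-- Reading a string. -/
def readAll (k L : ℕ) (s : Mode × Work) (ts : List Token) : Mode × Work :=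
  ts.foldl (readToken k L) s

/-- The abstract state before the first token. -/
def startWork (k L : ℕ) : Work := execAll L ⟨fun _ => L, fun _ => []⟩ (startCmds k)

/-- The string that the reduction writes. -/
def reductionText (k : ℕ) (ts : List Token) : List Token :=
  let w := (readAll k ts.length (.header 0, startWork k ts.length) ts).2
  w.out false ++ (w.out true ++ [Token.eqZero, Token.endPoly])

/-! ### The machine -/

/-- The stacks of the machine. -/
inductive StackName : Type
  | io
  | tmp
  | cmd
  | ruler
  | swept
  | out (b : Bool)
  deriving DecidableEq, Fintype

/-- The alphabets of the stacks. -/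
abbrev StackName.Sym (k : ℕ) : StackName → Type
  | .io => Token
  | .tmp => Token
  | .cmd => Cmd k
  | .ruler => Cell
  | .swept => Cell
  | .out _ => Token

/-- The labels of the machine. -/
inductive Label : Type
  | copy
  | uncopy
  | fetch
  | next
  | sweep
  | back
  | join (b : Bool)
  | clear
  deriving DecidableEq, Fintype

/-- The internal state of the machine: the mode and registers. -/
structure Ctl (k : ℕ) : Type where
  /-- the mode of the transducer -/
  mode : Mode
  /-- the last token read -/
  tok : Option Token
  /-- the last command read -/
  cmd : Option (Cmd k)
  /-- the last cell read -/
  cell : Option Cell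
  /-- the flag to be written into the next cell -/
  carry : Bool
  deriving DecidableEq, Fintype

/-- The initial internal state. -/
def Ctl.start (k : ℕ) : Ctl k := ⟨.header 0, none, none, none, false⟩

/-- The contents of all stacks. -/
structure Store (k : ℕ) : Type where
  /-- input and output -/
  io : List Token
  /-- auxiliary copy of the input -/
  tmp : List Token
  /-- pending commands -/
  cmd : List (Cmd k)
  /-- the part of the ruler to be swept -/
  ruler : List Cell
  /-- the part of the ruler already swept -/
  swept : List Cell
  /-- the output lists, last token first -/
  out : Bool → List Token

/-- The contents of a stack. -/
def Store.stk {k : ℕ} (S : Store k) : ∀ s : StackName, List (s.Sym k)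
  | .io => S.io
  | .tmp => S.tmp
  | .cmd => S.cmd
  | .ruler => S.ruler
  | .swept => S.swept
  | .out b => S.out b

section Store

variable {k : ℕ} (S : Store k)

@[simp] theorem Store.stk_io : S.stk .io = S.io := rfl
@[simp] theorem Store.stk_tmp : S.stk .tmp = S.tmp := rfl
@[simp] theorem Store.stk_cmd : S.stk .cmd = S.cmd := rfl
@[simp] theorem Store.stk_ruler : S.stk .ruler = S.ruler := rfl
@[simp] theorem Store.stk_swept : S.stk .swept = S.swept := rfl
@[simp] theorem Store.stk_out (b : Bool) : S.stk (.out b) = S.out b := rfl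

@[simp] theorem Store.update_io (l : List Token) :
    Function.update S.stk .io l = Store.stk { S with io := l } := by
  funext s; cases s <;> rfl

@[simp] theorem Store.update_tmp (l : List Token) :
    Function.update S.stk .tmp l = Store.stk { S with tmp := l } := by
  funext s; cases s <;> rfl

@[simp] theorem Store.update_cmd (l : List (Cmd k)) :
    Function.update S.stk .cmd l = Store.stk { S with cmd := l } := by
  funext s; cases s <;> rfl

@[simp] theorem Store.update_ruler (l : List Cell) :
    Function.update S.stk .ruler l = Store.stk { S with ruler := l } := by
  funext s; cases s <;> rfl

@[simp] theorem Store.update_swept (l : List Cell) :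
    Function.update S.stk .swept l = Store.stk { S with swept := l } := by
  funext s; cases s <;> rfl

@[simp] theorem Store.update_out (b : Bool) (l : List Token) :
    Function.update S.stk (.out b) l = Store.stk { S with out := Function.update S.out b l } := by
  funext s
  cases s with
  | out b' => cases b <;> cases b' <;> rfl
  | _ => rfl

end Store

/-! ### Derived statements for stack machines -/

namespace Turing.TM2.Stmt

variable {K Λ σ : Type} {Γ : K → Type}

/-- Branching over the whole internal state. -/
noncomputable def dispatch [Fintype σ] [DecidableEq σ] (F : σ → Turing.TM2.Stmt Γ Λ σ) :
    Turing.TM2.Stmt Γ Λ σ :=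
  (Finset.univ : Finset σ).toList.foldr (fun s q => branch (fun v => decide (v = s)) (F s) q) halt

/-- Pushing a list of symbols; the last one ends up on top. -/
def pushAll (s : K) (l : List (Γ s)) (q : Turing.TM2.Stmt Γ Λ σ) : Turing.TM2.Stmt Γ Λ σ :=
  l.foldr (fun a q => push s (fun _ => a) q) q

variable [DecidableEq K]

/-- Every state occurs in the enumeration, so the final `halt` is never reached. Dispatching lets
the stack and the number of pushed symbols depend on the internal state. -/
theorem stepAux_dispatch [Fintype σ] [DecidableEq σ] (F : σ → Turing.TM2.Stmt Γ Λ σ) (v : σ)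
    (S : ∀ s, List (Γ s)) : Turing.TM2.stepAux (dispatch F) v S = Turing.TM2.stepAux (F v) v S := by
  have key : ∀ l : List σ, v ∈ l → Turing.TM2.stepAux
      (l.foldr (fun s q => branch (fun v => decide (v = s)) (F s) q) halt) v S =
        Turing.TM2.stepAux (F v) v S := by
    intro l hl
    induction l with
    | nil => simp at hl
    | cons a l ih =>
      by_cases h : v = a
      · subst h; simp
      · have := ih (by simpa [h] using hl)
        simpa [h] using this
  exact key _ (by simp)

theorem stepAux_pushAll (s : K) (l : List (Γ s)) (q : Turing.TM2.Stmt Γ Λ σ) (v : σ)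
    (S : ∀ s, List (Γ s)) : Turing.TM2.stepAux (pushAll s l q) v S =
      Turing.TM2.stepAux q v (Function.update S s (l.reverse ++ S s)) := by
  induction l generalizing S with
  | nil => simp [pushAll]
  | cons a l ih =>
    simp only [pushAll, List.foldr_cons, Turing.TM2.stepAux] at ih ⊢
    rw [ih]
    simp

end Turing.TM2.Stmt

/-! ### The program and its single steps -/

section Machine

open Turing TM2.Stmt

/-- The flag carried into the first cell by a command. -/
def Cmd.initCarry {k : ℕ} : Cmd k → Bool
  | .reset _ => true
  | _ => false

/-- The flag carried from a cell to the next one by a command. -/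
def Cmd.nextCarry {k : ℕ} : Cmd k → Cell → Bool
  | .inc a, x => x a
  | _, _ => false

/-- The new contents of a cell. -/
def Cmd.newCell {k : ℕ} : Cmd k → Bool → Cell → Cell
  | .inc a, c, x => Function.update x a c
  | .reset a, c, x => Function.update x a c
  | _, _, x => x

/-- The program of the machine that computes `reductionText`. -/
noncomputable def program (k : ℕ) : Label → TM2.Stmt (StackName.Sym k) Label (Ctl k)
  | .copy => pop .io (fun (c : Ctl k) (t : Option Token) => { c with tok := t }) <|
      dispatch fun c => match c.tok with
        | none => goto fun _ => .uncopy
        | some t => push .tmp (fun _ => t) <| goto fun _ => .copy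
  | .uncopy => pop .tmp (fun (c : Ctl k) (t : Option Token) => { c with tok := t }) <|
      dispatch fun c => match c.tok with
        -- `pushAll` leaves the last symbol on top; the reversal makes the commands come off in
        -- their order.
        | none => pushAll .cmd (startCmds k).reverse <| goto fun _ => .fetch
        | some t => push .io (fun _ => t) <| push .ruler (fun _ _ => false) <|
            goto fun _ => .uncopy
  | .fetch => pop .cmd (fun (c : Ctl k) (t : Option (Cmd k)) => { c with cmd := t }) <|
      dispatch fun c => match c.cmd with
        | none => goto fun _ => .next
        | some (.put b t) => push (.out b) (fun _ => t) <| goto fun _ => .fetch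
        | some d => load (fun c => { c with carry := d.initCarry }) <| goto fun _ => .sweep
  | .next => pop .io (fun (c : Ctl k) (t : Option Token) => { c with tok := t }) <|
      dispatch fun c => match c.tok with
        | none => pushAll (.out true) [Token.eqZero, Token.endPoly] <| goto fun _ => .join true
        | some t => pushAll .cmd (transduce k c.mode t).2.reverse <|
            load (fun c => { c with mode := (transduce k c.mode t).1 }) <| goto fun _ => .fetch
  | .sweep => pop .ruler (fun (c : Ctl k) (x : Option Cell) => { c with cell := x }) <|
      dispatch fun c => match c.cell, c.cmd with
        -- For `inc`, the flag found in the old cell travels to the next one, which moves the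
        -- counter by one within a single sweep.
        | some x, some d => pushAll (.out d.target) (d.cellOut x) <|
            push .swept (fun _ => d.newCell c.carry x) <|
              load (fun c => { c with carry := d.nextCarry x }) <| goto fun _ => .sweep
        | _, _ => goto fun _ => .back
  | .back => pop .swept (fun (c : Ctl k) (x : Option Cell) => { c with cell := x }) <|
      dispatch fun c => match c.cell with
        | none => goto fun _ => .fetch
        | some x => push .ruler (fun _ => x) <| goto fun _ => .back
  | .join b => pop (.out b) (fun (c : Ctl k) (t : Option Token) => { c with tok := t }) <|
      dispatch fun c => match c.tok with
        -- The output is built on `io` from its end, so the list of constraints is moved first.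
        | none => goto fun _ => if b then .join false else .clear
        | some t => push .io (fun _ => t) <| goto fun _ => .join b
  | .clear => pop .ruler (fun (c : Ctl k) (x : Option Cell) => { c with cell := x }) <|
      dispatch fun c => match c.cell with
        -- A halting configuration must have the initial internal state, and all stacks except the
        -- output must be empty.
        | none => load (fun _ => Ctl.start k) halt
        | some _ => goto fun _ => .clear

/-- The configuration `b` is reached from `a` in at most `n` steps of the program. -/
def Within (k n : ℕ) (a b : TM2.Cfg (StackName.Sym k) Label (Ctl k)) : Prop :=
  Nonempty (StateTransition.EvalsToInTime (TM2.step (program k)) a (some b) n)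

variable {k : ℕ}

theorem Within.refl (n : ℕ) (a : TM2.Cfg (StackName.Sym k) Label (Ctl k)) : Within k n a a :=
  ⟨⟨⟨0, rfl⟩, Nat.zero_le n⟩⟩

theorem Within.trans {m n : ℕ} {a b c : TM2.Cfg (StackName.Sym k) Label (Ctl k)}
    (h₁ : Within k m a b) (h₂ : Within k n b c) : Within k (m + n) a c := by
  obtain ⟨h₁⟩ := h₁
  obtain ⟨h₂⟩ := h₂
  rw [Nat.add_comm]
  exact ⟨h₁.trans _ _ _ _ _ _ h₂⟩

theorem Within.mono {m n : ℕ} {a b : TM2.Cfg (StackName.Sym k) Label (Ctl k)}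
    (h : Within k m a b) (hmn : m ≤ n) : Within k n a b := by
  obtain ⟨h⟩ := h
  exact ⟨⟨h.toEvalsTo, h.steps_le_m.trans hmn⟩⟩

theorem Within.of_step {a b : TM2.Cfg (StackName.Sym k) Label (Ctl k)}
    (h : TM2.step (program k) a = some b) : Within k 1 a b :=
  ⟨⟨⟨1, by simpa [flip] using h⟩, le_rfl⟩⟩

theorem Within.head {n : ℕ} {a b c : TM2.Cfg (StackName.Sym k) Label (Ctl k)}
    (h : TM2.step (program k) a = some b) (h₂ : Within k n b c) : Within k (n + 1) a c := by
  rw [Nat.add_comm]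
  exact (Within.of_step h).trans h₂

/-- A running configuration. -/
abbrev cfg (l : Label) (c : Ctl k) (S : Store k) : TM2.Cfg (StackName.Sym k) Label (Ctl k) :=
  ⟨some l, c, S.stk⟩

theorem step_copy_cons (c : Ctl k) (S : Store k) (t : Token) (l : List Token) (h : S.io = t :: l) :
    TM2.step (program k) (cfg .copy c S) =
      some (cfg .copy { c with tok := some t } { S with io := l, tmp := t :: S.tmp }) := by
  simp [program, stepAux_dispatch, h]

theorem step_copy_nil (c : Ctl k) (S : Store k) (h : S.io = []) :
    TM2.step (program k) (cfg .copy c S) = some (cfg .uncopy { c with tok := none } S) := by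
  cases S; subst h; simp [program, stepAux_dispatch]

theorem step_uncopy_cons (c : Ctl k) (S : Store k) (t : Token) (l : List Token)
    (h : S.tmp = t :: l) : TM2.step (program k) (cfg .uncopy c S) =
      some (cfg .uncopy { c with tok := some t }
        { S with tmp := l, io := t :: S.io, ruler := (fun _ => false) :: S.ruler }) := by
  simp [program, stepAux_dispatch, h]

theorem step_uncopy_nil (c : Ctl k) (S : Store k) (h : S.tmp = []) :
    TM2.step (program k) (cfg .uncopy c S) =
      some (cfg .fetch { c with tok := none } { S with cmd := startCmds k ++ S.cmd }) := by
  cases S; subst h; simp [program, stepAux_dispatch, stepAux_pushAll]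

theorem step_fetch_put (c : Ctl k) (S : Store k) (b : Bool) (t : Token) (l : List (Cmd k))
    (h : S.cmd = .put b t :: l) : TM2.step (program k) (cfg .fetch c S) =
      some (cfg .fetch { c with cmd := some (.put b t) }
        { S with cmd := l, out := Function.update S.out b (t :: S.out b) }) := by
  simp [program, stepAux_dispatch, h]

theorem step_fetch_sweep (c : Ctl k) (S : Store k) (d : Cmd k) (l : List (Cmd k))
    (hd : ∀ b t, d ≠ .put b t) (h : S.cmd = d :: l) : TM2.step (program k) (cfg .fetch c S) =
      some (cfg .sweep { c with cmd := some d, carry := d.initCarry } { S with cmd := l }) := by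
  cases d <;> simp [program, stepAux_dispatch, h] at hd ⊢

theorem step_fetch_nil (c : Ctl k) (S : Store k) (h : S.cmd = []) :
    TM2.step (program k) (cfg .fetch c S) = some (cfg .next { c with cmd := none } S) := by
  cases S; subst h; simp [program, stepAux_dispatch]

theorem step_next_cons (c : Ctl k) (S : Store k) (t : Token) (l : List Token)
    (h : S.io = t :: l) : TM2.step (program k) (cfg .next c S) =
      some (cfg .fetch { c with tok := some t, mode := (transduce k c.mode t).1 }
        { S with io := l, cmd := (transduce k c.mode t).2 ++ S.cmd }) := by
  simp [program, stepAux_dispatch, stepAux_pushAll, h]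

theorem step_next_nil (c : Ctl k) (S : Store k) (h : S.io = []) :
    TM2.step (program k) (cfg .next c S) =
      some (cfg (.join true) { c with tok := none }
        { S with out :=
          Function.update S.out true ([Token.endPoly, Token.eqZero] ++ S.out true) }) := by
  cases S; subst h; simp [program, stepAux_dispatch, stepAux_pushAll]

theorem step_sweep_cons (c : Ctl k) (S : Store k) (d : Cmd k) (x : Cell) (l : List Cell)
    (hd : c.cmd = some d) (h : S.ruler = x :: l) : TM2.step (program k) (cfg .sweep c S) =
      some (cfg .sweep { c with cell := some x, carry := d.nextCarry x }
        { S with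
          ruler := l
          swept := d.newCell c.carry x :: S.swept
          out :=
            Function.update S.out d.target ((d.cellOut x).reverse ++ S.out d.target) }) := by
  simp [program, stepAux_dispatch, stepAux_pushAll, h, hd]

theorem step_sweep_nil (c : Ctl k) (S : Store k) (h : S.ruler = []) :
    TM2.step (program k) (cfg .sweep c S) = some (cfg .back { c with cell := none } S) := by
  cases S; subst h; simp [program, stepAux_dispatch]

theorem step_back_cons (c : Ctl k) (S : Store k) (x : Cell) (l : List Cell)
    (h : S.swept = x :: l) : TM2.step (program k) (cfg .back c S) =
      some (cfg .back { c with cell := some x } { S with swept := l, ruler := x :: S.ruler }) := by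
  simp [program, stepAux_dispatch, h]

theorem step_back_nil (c : Ctl k) (S : Store k) (h : S.swept = []) :
    TM2.step (program k) (cfg .back c S) = some (cfg .fetch { c with cell := none } S) := by
  cases S; subst h; simp [program, stepAux_dispatch]

theorem step_join_cons (c : Ctl k) (S : Store k) (b : Bool) (t : Token) (l : List Token)
    (h : S.out b = t :: l) : TM2.step (program k) (cfg (.join b) c S) =
      some (cfg (.join b) { c with tok := some t }
        { S with out := Function.update S.out b l, io := t :: S.io }) := by
  simp [program, stepAux_dispatch, h]

theorem step_join_nil (c : Ctl k) (S : Store k) (b : Bool) (h : S.out b = []) :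
    TM2.step (program k) (cfg (.join b) c S) =
      some (cfg (if b then .join false else .clear) { c with tok := none } S) := by
  have : Function.update S.out b [] = S.out := by rw [← h, Function.update_eq_self]
  simp [program, stepAux_dispatch, h, this]

theorem step_clear_cons (c : Ctl k) (S : Store k) (x : Cell) (l : List Cell)
    (h : S.ruler = x :: l) : TM2.step (program k) (cfg .clear c S) =
      some (cfg .clear { c with cell := some x } { S with ruler := l }) := by
  simp [program, stepAux_dispatch, h]

theorem step_clear_nil (c : Ctl k) (S : Store k) (h : S.ruler = []) :
    TM2.step (program k) (cfg .clear c S) = some ⟨none, Ctl.start k, S.stk⟩ := by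
  cases S; subst h; simp [program, stepAux_dispatch]

/-! ### The loops of the machine -/

theorem within_copy (l : List Token) (c : Ctl k) (S : Store k) (h : S.io = l) :
    ∃ c' : Ctl k, c'.mode = c.mode ∧ Within k (l.length + 1) (cfg .copy c S)
      (cfg .uncopy c' { S with io := [], tmp := l.reverse ++ S.tmp }) := by
  induction l generalizing c S with
  | nil =>
    refine ⟨{ c with tok := none }, rfl, Within.of_step ((step_copy_nil c S h).trans ?_)⟩
    cases S; subst h; rfl
  | cons t l ih =>
    obtain ⟨c', hc, hw⟩ := ih { c with tok := some t } { S with io := l, tmp := t :: S.tmp } rfl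
    exact ⟨c', hc, Within.head (step_copy_cons c S t l h) (by simpa using hw)⟩

theorem within_uncopy (l : List Token) (c : Ctl k) (S : Store k) (h : S.tmp = l) :
    ∃ c' : Ctl k, c'.mode = c.mode ∧ Within k (l.length + 1) (cfg .uncopy c S)
      (cfg .fetch c' { S with
        io := l.reverse ++ S.io
        tmp := []
        ruler := List.replicate l.length (fun _ => false) ++ S.ruler
        cmd := startCmds k ++ S.cmd }) := by
  induction l generalizing c S with
  | nil =>
    refine ⟨{ c with tok := none }, rfl, Within.of_step ((step_uncopy_nil c S h).trans ?_)⟩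
    cases S; subst h; rfl
  | cons t l ih =>
    obtain ⟨c', hc, hw⟩ := ih { c with tok := some t }
      { S with tmp := l, io := t :: S.io, ruler := (fun _ => false) :: S.ruler } rfl
    refine ⟨c', hc, Within.head (step_uncopy_cons c S t l h) ?_⟩
    simpa [List.replicate_succ', List.append_assoc] using hw

/-- The flag carried into cell number `s` by a command. -/
def Cmd.carryAt (ptr : Ptr → ℕ) (s : ℕ) : Cmd k → Bool
  | .inc a => decide (s = ptr a + 1)
  | .reset _ => decide (s = 0)
  | _ => false

theorem Cmd.nextCarry_cellAt (d : Cmd k) (ptr : Ptr → ℕ) (s : ℕ) :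
    d.nextCarry (cellAt ptr s) = d.carryAt ptr (s + 1) := by
  cases d <;> simp [Cmd.nextCarry, Cmd.carryAt, cellAt]

/-- For `inc` and `reset` the incoming flag says whether the new position of the counter is `s`, so
local rewriting from left to right realises the move. A counter pushed past the last cell leaves no
mark, in agreement with `cellAt`. -/
theorem Cmd.newCell_cellAt (d : Cmd k) (ptr : Ptr → ℕ) (s : ℕ) :
    d.newCell (d.carryAt ptr s) (cellAt ptr s) = cellAt (d.movePtr ptr) s := by
  cases d <;> simp only [Cmd.newCell, Cmd.carryAt, Cmd.movePtr]
  all_goals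
    funext b
    rename_i a
    by_cases hb : b = a <;> [subst hb; skip] <;> simp [cellAt, *]

/-- The ruler starts at an arbitrary cell `s` to allow induction on the remaining cells; the
hypothesis on the carried flag is the loop invariant. -/
theorem within_sweep (d : Cmd k) (ptr : Ptr → ℕ) (n s : ℕ) (c : Ctl k) (S : Store k)
    (hd : c.cmd = some d) (hc : c.carry = d.carryAt ptr s)
    (h : S.ruler = (List.range' s n).map (cellAt ptr)) :
    ∃ c' : Ctl k, c'.mode = c.mode ∧ Within k (n + 1) (cfg .sweep c S)
      (cfg .back c' { S with
        ruler := []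
        swept := ((List.range' s n).map (cellAt (d.movePtr ptr))).reverse ++ S.swept
        out := Function.update S.out d.target
          (((List.range' s n).flatMap fun x => d.cellOut (cellAt ptr x)).reverse ++
            S.out d.target) }) := by
  induction n generalizing s c S with
  | zero =>
    rw [List.range'_zero, List.map_nil] at h
    refine ⟨{ c with cell := none }, rfl, Within.of_step ((step_sweep_nil c S h).trans ?_)⟩
    cases S; subst h; simp
  | succ n ih =>
    rw [List.range'_succ, List.map_cons] at h
    have hs := step_sweep_cons c S d _ _ hd h
    rw [hc, d.newCell_cellAt, d.nextCarry_cellAt] at hs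
    obtain ⟨c', hm, hw⟩ := ih (s + 1) { c with
        cell := some (cellAt ptr s)
        carry := d.carryAt ptr (s + 1) } { S with
        ruler := (List.range' (s + 1) n).map (cellAt ptr)
        swept := cellAt (d.movePtr ptr) s :: S.swept
        out := Function.update S.out d.target
          ((d.cellOut (cellAt ptr s)).reverse ++ S.out d.target) } hd rfl rfl
    exact ⟨c', hm, Within.head hs (by simpa [List.range'_succ] using hw)⟩

theorem within_back (l : List Cell) (c : Ctl k) (S : Store k) (h : S.swept = l) :
    ∃ c' : Ctl k, c'.mode = c.mode ∧ Within k (l.length + 1) (cfg .back c S)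
      (cfg .fetch c' { S with swept := [], ruler := l.reverse ++ S.ruler }) := by
  induction l generalizing c S with
  | nil =>
    refine ⟨{ c with cell := none }, rfl, Within.of_step ((step_back_nil c S h).trans ?_)⟩
    cases S; subst h; rfl
  | cons t l ih =>
    obtain ⟨c', hc, hw⟩ := ih { c with cell := some t }
      { S with swept := l, ruler := t :: S.ruler } rfl
    exact ⟨c', hc, Within.head (step_back_cons c S t l h) (by simpa using hw)⟩

theorem within_join (l : List Token) (b : Bool) (c : Ctl k) (S : Store k) (h : S.out b = l) :
    ∃ c' : Ctl k, Within k (l.length + 1) (cfg (.join b) c S)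
      (cfg (if b then .join false else .clear) c'
        { S with out := Function.update S.out b [], io := l.reverse ++ S.io }) := by
  induction l generalizing c S with
  | nil =>
    refine ⟨{ c with tok := none }, Within.of_step ((step_join_nil c S b h).trans ?_)⟩
    rw [← h, Function.update_eq_self, h]; rfl
  | cons t l ih =>
    obtain ⟨c', hw⟩ := ih { c with tok := some t }
      { S with out := Function.update S.out b l, io := t :: S.io } (by simp)
    exact ⟨c', Within.head (step_join_cons c S b t l h) (by simpa using hw)⟩

theorem within_clear (l : List Cell) (c : Ctl k) (S : Store k) (h : S.ruler = l) :
    Within k (l.length + 1) (cfg .clear c S)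
      ⟨none, Ctl.start k, Store.stk { S with ruler := [] }⟩ := by
  induction l generalizing c S with
  | nil =>
    have := Within.of_step (step_clear_nil c S h)
    cases S; subst h; exact this
  | cons t l ih => exact Within.head (step_clear_cons c S t l h) (ih _ { S with ruler := l } rfl)

end Machine

/-! ### The machine follows the abstract run -/

section Run

open Turing

variable {k : ℕ}

/-- The stacks that represent an abstract state. -/
def Store.ofWork (L : ℕ) (io : List Token) (cs : List (Cmd k)) (w : Work) : Store k where
  io := io
  tmp := []
  cmd := cs
  ruler := (List.range L).map (cellAt w.ptr)
  swept := []
  out b := (w.out b).reverse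

theorem Store.ofWork_exec_out (L : ℕ) (w : Work) (d : Cmd k) :
    Function.update (fun b => (w.out b).reverse) d.target
      ((d.text L w.ptr).reverse ++ (w.out d.target).reverse) =
        fun b => ((d.exec L w).out b).reverse := by
  funext b
  by_cases h : b = d.target
  · subst h; simp [Cmd.exec]
  · simp [Cmd.exec, h]

/-- A `put` is one step. Any other command costs one step for fetching, `L + 1` for the sweep and `L
+ 1` for the way back. -/
theorem within_exec (L : ℕ) (io : List Token) (cs : List (Cmd k)) (d : Cmd k) (w : Work)
    (c : Ctl k) : ∃ c' : Ctl k, c'.mode = c.mode ∧ Within k (2 * L + 3)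
      (cfg .fetch c (Store.ofWork L io (d :: cs) w))
      (cfg .fetch c' (Store.ofWork L io cs (d.exec L w))) := by
  by_cases hd : ∃ b t, d = .put b t
  · obtain ⟨b, t, rfl⟩ := hd
    refine ⟨{ c with cmd := some (.put b t) }, rfl,
      (Within.of_step ((step_fetch_put c _ b t cs rfl).trans ?_)).mono
        (Nat.le_add_left 1 (2 * L + 2))⟩
    · have := Store.ofWork_exec_out L w (.put b t : Cmd k)
      simp only [Cmd.text, Cmd.target, List.reverse_singleton, List.singleton_append] at this
      simp only [Store.ofWork, this]
      rfl
  · push Not at hd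
    have htext : d.text L w.ptr =
        (List.range' 0 L).flatMap fun x => d.cellOut (cellAt w.ptr x) := by
      rw [← List.range_eq_range']
      cases d with
      | put b t => exact absurd rfl (hd b t)
      | _ => rfl
    obtain ⟨c₁, hc₁, h₁⟩ := within_sweep d w.ptr L 0
      { c with cmd := some d, carry := d.initCarry } (Store.ofWork L io cs w) rfl
      (by cases d <;> rfl)
      (by simp [Store.ofWork, List.range_eq_range'])
    rw [← htext] at h₁
    have hout := Store.ofWork_exec_out L w d
    simp only [Store.ofWork, hout, List.append_nil] at h₁
    obtain ⟨c₂, hc₂, h₂⟩ := within_back _ c₁ ⟨io, [], cs, [], _, _⟩ rfl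
    refine ⟨c₂, hc₂.trans hc₁, ?_⟩
    have h := Within.head (step_fetch_sweep c (Store.ofWork L io (d :: cs) w) d cs hd rfl)
      (h₁.trans h₂)
    simp only [List.reverse_reverse, List.append_nil, ← List.range_eq_range'] at h
    refine h.mono ?_
    simp only [List.length_reverse, List.length_map, List.length_range]
    omega

theorem within_execAll (L : ℕ) (io : List Token) (cs : List (Cmd k)) (w : Work) (c : Ctl k) :
    ∃ c' : Ctl k, c'.mode = c.mode ∧ Within k (cs.length * (2 * L + 3) + 1)
      (cfg .fetch c (Store.ofWork L io cs w))
      (cfg .next c' (Store.ofWork L io [] (execAll L w cs))) := by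
  induction cs generalizing w c with
  | nil =>
    exact ⟨{ c with cmd := none }, rfl, (Within.of_step (step_fetch_nil c _ rfl)).mono (by simp)⟩
  | cons d cs ih =>
    obtain ⟨c₁, hc₁, h₁⟩ := within_exec L io cs d w c
    obtain ⟨c₂, hc₂, h₂⟩ := ih (d.exec L w) c₁
    refine ⟨c₂, hc₂.trans hc₁, (h₁.trans h₂).mono (le_of_eq ?_)⟩
    rw [List.length_cons]
    ring

/-- The largest number of commands that one token causes. -/
noncomputable def maxCmds (k : ℕ) : ℕ :=
  Finset.univ.sup fun s : Mode × Token => (transduce k s.1 s.2).2.length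

theorem length_transduce_le (m : Mode) (t : Token) : (transduce k m t).2.length ≤ maxCmds k :=
  Finset.le_sup (f := fun s : Mode × Token => (transduce k s.1 s.2).2.length)
    (Finset.mem_univ (m, t))

/-- A token costs one step for reading, one for noticing that no command is left, and at most `2 * L
+ 3` for each of its commands, whose number is bounded independently of the input. -/
theorem within_readAll (L : ℕ) (ts : List Token) (s : Mode × Work) (c : Ctl k)
    (hc : c.mode = s.1) :
    ∃ c' : Ctl k, Within k (ts.length * (maxCmds k * (2 * L + 3) + 2))
      (cfg .next c (Store.ofWork L ts [] s.2))
      (cfg .next c' (Store.ofWork L [] [] (readAll k L s ts).2)) := by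
  induction ts generalizing s c with
  | nil => exact ⟨c, Within.refl _ _⟩
  | cons t ts ih =>
    have h₀ := step_next_cons c (Store.ofWork L (t :: ts) [] s.2) t ts rfl
    rw [hc] at h₀
    obtain ⟨c₁, hc₁, h₁⟩ := within_execAll L ts (transduce k s.1 t).2 s.2
      { c with tok := some t, mode := (transduce k s.1 t).1 }
    obtain ⟨c₂, h₂⟩ := ih (readToken k L s t) c₁ hc₁
    have h := Within.head h₀ (Within.trans (by simpa [Store.ofWork, readToken] using h₁) h₂)
    refine ⟨c₂, h.mono ?_⟩
    have := Nat.mul_le_mul_right (2 * L + 3) (length_transduce_le (k := k) s.1 t)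
    rw [List.length_cons, Nat.add_mul, Nat.one_mul]
    omega

/-- The number of steps of the machine on inputs of length `L`, not counting the copying of
the output. -/
noncomputable def workTime (k L : ℕ) : ℕ :=
  3 * L + 8 + 2 * (2 * L + 3) + L * (maxCmds k * (2 * L + 3) + 2)

theorem within_reduction (ts : List Token) :
    Within k (workTime k ts.length + (reductionText k ts).length)
      ⟨some .copy, Ctl.start k, Store.stk ⟨ts, [], [], [], [], fun _ => []⟩⟩
      ⟨none, Ctl.start k, Store.stk ⟨reductionText k ts, [], [], [], [], fun _ => []⟩⟩ := by
  obtain ⟨c₁, hc₁, h₁⟩ := within_copy ts (Ctl.start k) ⟨ts, [], [], [], [], fun _ => []⟩ rfl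
  obtain ⟨c₂, hc₂, h₂⟩ := within_uncopy (k := k) ts.reverse c₁
    ⟨[], ts.reverse, [], [], [], fun _ => []⟩ rfl
  -- Counters with the value `L` point past the ruler, which matches the blank cells laid down by
  -- `uncopy`.
  have hr : (List.range ts.length).map (cellAt fun _ => ts.length) =
      List.replicate ts.length fun _ => false := by
    refine List.eq_replicate_iff.2 ⟨by simp, fun x hx => ?_⟩
    obtain ⟨y, hy, rfl⟩ := List.mem_map.1 hx
    funext a
    simpa [cellAt] using (List.mem_range.1 hy).ne
  obtain ⟨c₃, hc₃, h₃⟩ := within_execAll ts.length ts (startCmds k)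
    ⟨fun _ => ts.length, fun _ => []⟩ c₂
  obtain ⟨c₄, h₄⟩ := within_readAll (k := k) ts.length ts (.header 0, startWork k ts.length) c₃
    (by rw [hc₃, hc₂, hc₁]; rfl)
  set w := (readAll k ts.length (.header 0, startWork k ts.length) ts).2 with hw
  have h₅ := step_next_nil c₄ (Store.ofWork ts.length [] [] w) rfl
  obtain ⟨c₆, h₆⟩ := within_join ([Token.endPoly, Token.eqZero] ++ (w.out true).reverse) true
    { c₄ with tok := none } ⟨[], [], [], (List.range ts.length).map (cellAt w.ptr), [],
      Function.update (fun b => (w.out b).reverse) true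
        ([Token.endPoly, Token.eqZero] ++ (w.out true).reverse)⟩ (by simp)
  obtain ⟨c₇, h₇⟩ := within_join (w.out false).reverse false c₆
    ⟨w.out true ++ [Token.eqZero, Token.endPoly], [], [],
      (List.range ts.length).map (cellAt w.ptr), [],
      Function.update (fun b => (w.out b).reverse) true []⟩ (by simp)
  have h₈ := within_clear ((List.range ts.length).map (cellAt w.ptr)) c₇
    ⟨w.out false ++ (w.out true ++ [Token.eqZero, Token.endPoly]), [], [],
      (List.range ts.length).map (cellAt w.ptr), [], fun _ => []⟩ rfl
  have hnil : Function.update (Function.update (fun b => (w.out b).reverse) true []) false [] =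
      fun _ => [] := by
    funext b; cases b <;> rfl
  simp only [List.append_nil] at h₁
  simp only [List.append_nil, List.reverse_reverse, List.length_reverse] at h₂
  simp only [Store.ofWork, hr, List.reverse_nil] at h₃
  simp only [Store.ofWork] at h₄ h₅
  simp only [Function.update_idem, List.reverse_append, List.reverse_reverse, List.append_nil,
    if_true, List.reverse_cons, List.reverse_nil, List.nil_append, List.singleton_append] at h₆
  simp only [hnil, List.reverse_reverse, Bool.false_eq_true, if_false] at h₇
  have h := h₁.trans (h₂.trans (h₃.trans (h₄.trans (Within.head h₅ (h₆.trans (h₇.trans h₈))))))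
  refine h.mono ?_
  simp only [workTime, reductionText, ← hw, startCmds, List.length_append, List.length_reverse,
    List.length_cons, List.length_nil, List.length_map, List.length_range]
  omega

end Run

/-! ### Polynomial bounds for output length and running time -/

section PolyTime

open Turing

variable {k : ℕ}

/-- The total length of the output lists. -/
def Work.size (w : Work) : ℕ := (w.out false).length + (w.out true).length

/-- The largest length of the string that a command writes for one cell. -/
noncomputable def maxCellOut (k : ℕ) : ℕ :=
  Finset.univ.sup fun s : Cmd k × Cell => (s.1.cellOut s.2).length

theorem Cmd.length_text_le (L : ℕ) (ptr : Ptr → ℕ) (d : Cmd k) :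
    (d.text L ptr).length ≤ L * maxCellOut k + 1 := by
  have key : ((List.range L).flatMap fun x => d.cellOut (cellAt ptr x)).length ≤
      L * maxCellOut k := by
    rw [List.length_flatMap]
    refine (List.sum_le_card_nsmul _ (maxCellOut k) ?_).trans (by simp)
    intro n hn
    obtain ⟨x, -, rfl⟩ := List.mem_map.1 hn
    exact Finset.le_sup (f := fun s : Cmd k × Cell => (s.1.cellOut s.2).length)
      (Finset.mem_univ (d, cellAt ptr x))
  cases d with
  | put b t => simp [Cmd.text]
  | _ => exact key.trans (Nat.le_succ _)

theorem Cmd.size_exec_le (L : ℕ) (w : Work) (d : Cmd k) :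
    (d.exec L w).size ≤ w.size + (L * maxCellOut k + 1) := by
  have h := d.length_text_le L w.ptr
  unfold Work.size Cmd.exec
  cases d.target <;> simp <;> omega

theorem size_execAll_le (L : ℕ) (w : Work) (cs : List (Cmd k)) :
    (execAll L w cs).size ≤ w.size + cs.length * (L * maxCellOut k + 1) := by
  induction cs generalizing w with
  | nil => simp [execAll]
  | cons d cs ih =>
    have h₁ := d.size_exec_le L w
    have h₂ := ih (d.exec L w)
    rw [List.length_cons, Nat.add_mul, Nat.one_mul]
    exact h₂.trans (by omega)

theorem size_readAll_le (L : ℕ) (s : Mode × Work) (ts : List Token) :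
    (readAll k L s ts).2.size ≤
      s.2.size + ts.length * (maxCmds k * (L * maxCellOut k + 1)) := by
  induction ts generalizing s with
  | nil => simp [readAll]
  | cons t ts ih =>
    have h₁ := size_execAll_le L s.2 (transduce k s.1 t).2
    have h₂ := ih (readToken k L s t)
    have h₃ := Nat.mul_le_mul_right (L * maxCellOut k + 1) (length_transduce_le (k := k) s.1 t)
    rw [List.length_cons, Nat.add_mul, Nat.one_mul]
    refine h₂.trans ?_
    simp only [readToken]
    omega

/-- The final copying takes time proportional to the output, so its length needs a bound too. It is
quadratic: each token causes boundedly many commands, and each writes boundedly many tokens per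
cell. -/
theorem length_reductionText_le (ts : List Token) :
    (reductionText k ts).length ≤ 2 * (ts.length * maxCellOut k + 1) +
      ts.length * (maxCmds k * (ts.length * maxCellOut k + 1)) + 2 := by
  have h₁ := size_readAll_le (k := k) ts.length (.header 0, startWork k ts.length) ts
  have h₂ := size_execAll_le (k := k) ts.length ⟨fun _ => ts.length, fun _ => []⟩ (startCmds k)
  simp only [Work.size, startWork, startCmds, List.length_cons, List.length_nil] at h₁ h₂
  simp only [reductionText, List.length_append, List.length_cons, List.length_nil, startWork,
    startCmds]
  omega

/-- The machine that computes `reductionText`. -/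
noncomputable def reductionMachine (k : ℕ) : FinTM2 where
  K := StackName
  k₀ := .io
  k₁ := .io
  Γ := StackName.Sym k
  Λ := Label
  main := .copy
  σ := Ctl k
  initialState := Ctl.start k
  Γk₀Fin := inferInstanceAs (Fintype Token)
  m := program k

theorem reductionMachine_outputs {n : ℕ} {l l' : List Token}
    (h : Within k n ⟨some .copy, Ctl.start k, Store.stk ⟨l, [], [], [], [], fun _ => []⟩⟩
      ⟨none, Ctl.start k, Store.stk ⟨l', [], [], [], [], fun _ => []⟩⟩) :
    Nonempty (TM2OutputsInTime (reductionMachine k) l (some l') n) := by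
  -- In this form the stacks are literally those of the initial and halting configurations, and the
  -- claim becomes true by definition.
  have e : ∀ l : List Token, Store.stk (k := k) ⟨l, [], [], [], [], fun _ => []⟩ =
      fun s => if hs : s = StackName.io then by rw [hs]; exact l else [] := by
    intro l; funext s; cases s <;> rfl
  rw [e, e] at h
  exact h

/-- A polynomial bound for the number of steps of the machine. -/
noncomputable def timePolynomial (k : ℕ) : Polynomial ℕ :=
  3 * Polynomial.X + 8 + 2 * (2 * Polynomial.X + 3) +
    Polynomial.X * (Polynomial.C (maxCmds k) * (2 * Polynomial.X + 3) + 2) +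
    (2 * (Polynomial.X * Polynomial.C (maxCellOut k) + 1) +
      Polynomial.X * (Polynomial.C (maxCmds k) *
        (Polynomial.X * Polynomial.C (maxCellOut k) + 1)) + 2)

theorem eval_timePolynomial (L : ℕ) : (timePolynomial k).eval L =
    workTime k L + (2 * (L * maxCellOut k + 1) +
      L * (maxCmds k * (L * maxCellOut k + 1)) + 2) := by
  simp only [timePolynomial, workTime, Polynomial.eval_add, Polynomial.eval_mul,
    Polynomial.eval_X, Polynomial.eval_C, Polynomial.eval_ofNat, Polynomial.eval_one]

/-- A function whose values are written by `reductionText` is computable in polynomial time. -/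
theorem computableInPolyTime_of_reductionText {α β : Type} (ea : α → List Token)
    (eb : β → List Token) (f : α → β) (h : ∀ x, eb (f x) = reductionText k (ea x)) :
    Nonempty (TM2ComputableInPolyTime ea eb f) := by
  have key : ∀ x, Nonempty (TM2OutputsInTime (reductionMachine k) (ea x) (some (eb (f x)))
      ((timePolynomial k).eval (ea x).length)) := by
    intro x
    rw [h x, eval_timePolynomial]
    exact reductionMachine_outputs ((within_reduction (k := k) (ea x)).mono
      (Nat.add_le_add_left (length_reductionText_le (k := k) (ea x)) _))
  exact ⟨{
    tm := reductionMachine k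
    inputAlphabet := Equiv.refl Token
    outputAlphabet := Equiv.refl Token
    time := timePolynomial k
    outputsFun := fun x => by
      have hid : ∀ l : List Token, l.map (Equiv.refl Token).invFun = l := List.map_id
      exact cast (congrArg₂ (fun l l' : List Token => TM2OutputsInTime (reductionMachine k) l
        (some l') ((timePolynomial k).eval (ea x).length)) (hid _).symm (hid _).symm)
        (key x).some }⟩

end PolyTime

/-! ### The sentence written by the reduction -/

section Sentence

/-- The exponent vector of a product of variables; a variable is given by a cell and a slot. -/
def expVec (L : ℕ) {c : ℕ} (G : List (ℕ × Fin c)) : Fin (L * c) → ℕ := fun v =>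
  (G.map fun g => if (v.divNat : ℕ) = g.1 ∧ v.modNat = g.2 then 1 else 0).sum

/-- The polynomial `num + den * R_p` of a rational number. -/
def ratPoly (k L p : ℕ) (r : ℚ) : SparsePoly (L * (k + k + 1)) :=
  [(r.num, expVec L []), ((r.den : ℤ), expVec L [(p, slotR k)])]

/-- The monomials `R_p * U_it * V_tj`, `t < k`. -/
def prodMonomials (k L i j p : ℕ) : SparsePoly (L * (k + k + 1)) :=
  (List.finRange k).map fun t => (1, expVec L [(i, slotU t), (j, slotV t), (p, slotR k)])

/-- The polynomial of a constraint; its rational numbers have the indices from `p` on. -/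
def constraintPoly (k L m n p : ℕ) : SparsePoly (L * (k + k + 1)) :=
  (List.ofFn fun i : Fin m => (List.ofFn fun j : Fin n =>
    prodMonomials k L (i + 1) j (p + i * n + j)).flatten).flatten ++
      [(-1, expVec L [(p + m * n, slotR k)])]

/-- The polynomials of the rational numbers of a constraint. -/
def ratPolys (k L p : ℕ) {m n : ℕ} (c : (Fin m → Fin n → ℚ) × ℚ) :
    List (SparsePoly (L * (k + k + 1))) :=
  (List.ofFn fun i : Fin m => List.ofFn fun j : Fin n =>
    ratPoly k L (p + i * n + j) (c.1 i j)).flatten ++ [ratPoly k L (p + m * n) c.2]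

/-- The conjunction of the equations `p = 0`. -/
def conjAll {N : ℕ} : List (SparsePoly N) → QFFormula N
  | [] => .atom .eqZero []
  | p :: ps => .conj (.atom .eqZero p) (conjAll ps)

/-- Nested to the right, a conjunction in prefix notation is a plain sequence of equations closed by
the trivial `0 = 0`. Hence the two output lists need only be concatenated. -/
theorem encode_conjAll {N : ℕ} (ps : List (SparsePoly N)) : (conjAll ps).encode =
    (ps.flatMap fun p => Token.conj :: Token.eqZero :: encPoly p) ++
      [Token.eqZero, Token.endPoly] := by
  induction ps with
  | nil => rfl
  | cons p ps ih => simp [conjAll, QFFormula.encode, AtomKind.sym, ih]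

theorem sat_conjAll {N : ℕ} (ps : List (SparsePoly N)) (x : Fin N → ℝ) :
    (conjAll ps).Sat x ↔ ∀ p ∈ ps, p.eval x = 0 := by
  induction ps with
  | nil => simp [conjAll, QFFormula.Sat, AtomKind.Holds, SparsePoly.eval]
  | cons p ps ih => simp [conjAll, QFFormula.Sat, AtomKind.Holds, ih]

/-- The polynomials of the rational numbers of an instance. -/
def ARMInstance.ratPolys (k L : ℕ) (I : ARMInstance) : List (SparsePoly (L * (k + k + 1))) :=
  (List.ofFn fun l : Fin I.q =>
    _root_.ratPolys k L (l * (I.m * I.n + 1)) ((fun i j => I.A l i j), I.b l)).flatten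

/-- The polynomials of the constraints of an instance. -/
def ARMInstance.constraintPolys (k L : ℕ) (I : ARMInstance) :
    List (SparsePoly (L * (k + k + 1))) :=
  List.ofFn fun l : Fin I.q => constraintPoly k L I.m I.n (l * (I.m * I.n + 1))

/-- The sentence to which an instance is reduced. -/
def ARMInstance.toETR (k : ℕ) (I : ARMInstance) : ETRSentence where
  N := I.encode.length * (k + k + 1)
  φ := conjAll (I.ratPolys k I.encode.length ++ I.constraintPolys k I.encode.length)

end Sentence

/-! ### The text of the abstract run -/

section Text

variable {k : ℕ}

/-- The effect of commands on the counters. -/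
def cmdsPtr (ptr : Ptr → ℕ) (cs : List (Cmd k)) : Ptr → ℕ := cs.foldl (fun p c => c.movePtr p) ptr

/-- The string that commands append to an output list. -/
def cmdsText (L : ℕ) (b : Bool) : (Ptr → ℕ) → List (Cmd k) → List Token
  | _, [] => []
  | ptr, c :: cs => (if c.target = b then c.text L ptr else []) ++ cmdsText L b (c.movePtr ptr) cs

/-- The counters evolve independently of the output, and the text written depends only on them.
Counters and the two lists can therefore be treated separately. -/
theorem execAll_eq (L : ℕ) (w : Work) (cs : List (Cmd k)) :
    execAll L w cs = ⟨cmdsPtr w.ptr cs, fun b => w.out b ++ cmdsText L b w.ptr cs⟩ := by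
  induction cs generalizing w with
  | nil => simp [execAll, cmdsPtr, cmdsText]
  | cons c cs ih =>
    refine (ih (c.exec L w)).trans ?_
    simp only [cmdsPtr, List.foldl_cons, Cmd.exec, cmdsText, Work.mk.injEq, true_and]
    funext b
    by_cases h : c.target = b
    · subst h; simp
    · simp [h, Function.update_of_ne (Ne.symm h)]

theorem cmdsPtr_append (ptr : Ptr → ℕ) (cs ds : List (Cmd k)) :
    cmdsPtr ptr (cs ++ ds) = cmdsPtr (cmdsPtr ptr cs) ds := List.foldl_append

theorem cmdsText_append (L : ℕ) (b : Bool) (ptr : Ptr → ℕ) (cs ds : List (Cmd k)) :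
    cmdsText L b ptr (cs ++ ds) = cmdsText L b ptr cs ++ cmdsText L b (cmdsPtr ptr cs) ds := by
  induction cs generalizing ptr with
  | nil => rfl
  | cons c cs ih => simp [cmdsText, ih, cmdsPtr]

/-- The mode and the counters after reading a token. -/
def nextCtl (k : ℕ) (s : Mode × (Ptr → ℕ)) (t : Token) : Mode × (Ptr → ℕ) :=
  ((transduce k s.1 t).1, cmdsPtr s.2 (transduce k s.1 t).2)

/-- The mode and the counters after reading a string. -/
def readCtl (k : ℕ) (s : Mode × (Ptr → ℕ)) (ts : List Token) : Mode × (Ptr → ℕ) :=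
  ts.foldl (nextCtl k) s

/-- The string that is appended to an output list while a string is read. -/
def readText (k L : ℕ) (b : Bool) : Mode × (Ptr → ℕ) → List Token → List Token
  | _, [] => []
  | s, t :: ts => cmdsText L b s.2 (transduce k s.1 t).2 ++ readText k L b (nextCtl k s t) ts

theorem readAll_eq (L : ℕ) (m : Mode) (w : Work) (ts : List Token) :
    readAll k L (m, w) ts = ((readCtl k (m, w.ptr) ts).1, ⟨(readCtl k (m, w.ptr) ts).2,
      fun b => w.out b ++ readText k L b (m, w.ptr) ts⟩) := by
  induction ts generalizing m w with
  | nil => simp [readAll, readCtl, readText]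
  | cons t ts ih =>
    have := ih (readToken k L (m, w) t).1 (readToken k L (m, w) t).2
    refine Eq.trans this ?_
    simp [readToken, execAll_eq, readCtl, readText, nextCtl]

theorem readCtl_append (s : Mode × (Ptr → ℕ)) (ts us : List Token) :
    readCtl k s (ts ++ us) = readCtl k (readCtl k s ts) us := List.foldl_append

theorem readText_append (L : ℕ) (b : Bool) (s : Mode × (Ptr → ℕ)) (ts us : List Token) :
    readText k L b s (ts ++ us) = readText k L b s ts ++ readText k L b (readCtl k s ts) us := by
  induction ts generalizing s with
  | nil => rfl
  | cons t ts ih => simp [readText, ih, readCtl]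

/-- Reading `ts` in the state `s` leads to the state `s'` and appends `d₀` and `d₁` to the output
lists. -/
def Reads (k L : ℕ) (s : Mode × (Ptr → ℕ)) (ts : List Token) (s' : Mode × (Ptr → ℕ))
    (d₀ d₁ : List Token) : Prop :=
  readCtl k s ts = s' ∧ readText k L false s ts = d₀ ∧ readText k L true s ts = d₁

theorem Reads.nil (L : ℕ) (s : Mode × (Ptr → ℕ)) : Reads k L s [] s [] [] := ⟨rfl, rfl, rfl⟩

theorem Reads.append {L : ℕ} {s s' s'' : Mode × (Ptr → ℕ)} {ts us d₀ d₁ e₀ e₁ : List Token}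
    (h : Reads k L s ts s' d₀ d₁) (h' : Reads k L s' us s'' e₀ e₁) :
    Reads k L s (ts ++ us) s'' (d₀ ++ e₀) (d₁ ++ e₁) := by
  obtain ⟨rfl, rfl, rfl⟩ := h
  obtain ⟨rfl, rfl, rfl⟩ := h'
  exact ⟨readCtl_append .., readText_append .., readText_append ..⟩

theorem Reads.cons {L : ℕ} {m m' : Mode} {ptr : Ptr → ℕ} {t : Token} {cs : List (Cmd k)}
    {s'' : Mode × (Ptr → ℕ)} {us e₀ e₁ : List Token} (h : transduce k m t = (m', cs))
    (h' : Reads k L (m', cmdsPtr ptr cs) us s'' e₀ e₁) : Reads k L (m, ptr) (t :: us) s''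
      (cmdsText L false ptr cs ++ e₀) (cmdsText L true ptr cs ++ e₁) := by
  obtain ⟨rfl, rfl, rfl⟩ := h'
  simp [Reads, readCtl, readText, nextCtl, h]

theorem Reads.single {L : ℕ} {m m' : Mode} {ptr : Ptr → ℕ} {t : Token} {cs : List (Cmd k)}
    (h : transduce k m t = (m', cs)) : Reads k L (m, ptr) [t] (m', cmdsPtr ptr cs)
      (cmdsText L false ptr cs) (cmdsText L true ptr cs) := by
  simpa using Reads.cons h (Reads.nil L _)

theorem Reads.congr {L : ℕ} {s s' s'' : Mode × (Ptr → ℕ)} {ts us d₀ d₁ e₀ e₁ : List Token}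
    (h : Reads k L s ts s' d₀ d₁) (ht : us = ts) (hs : s' = s'') (h₀ : d₀ = e₀) (h₁ : d₁ = e₁) :
    Reads k L s us s'' e₀ e₁ := by
  subst ht hs h₀ h₁; exact h

/-- `P x` is an invariant of mode and counters before entry `x`. The state is known only up to this
invariant, so counters that no longer matter need not be tracked. -/
theorem Reads.encFin {α : Type} (L : ℕ) (e : α → List Token) {n : ℕ} (f : Fin n → α)
    (P : ℕ → Mode × (Ptr → ℕ) → Prop) (d₀ d₁ : Fin n → List Token)
    (h : ∀ (x : Fin n) s, P x s → ∃ s', P (x + 1) s' ∧ Reads k L s (e (f x)) s' (d₀ x) (d₁ x))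
    (s : Mode × (Ptr → ℕ)) (hs : P 0 s) : ∃ s', P n s' ∧
      Reads k L s (encFin e f) s' (List.ofFn d₀).flatten (List.ofFn d₁).flatten := by
  induction n generalizing s P with
  | zero => exact ⟨s, hs, by simpa [_root_.encFin] using Reads.nil L s⟩
  | succ n ih =>
    obtain ⟨s₁, h₁, h₂⟩ := h 0 s hs
    obtain ⟨s₂, h₃, h₄⟩ := ih (fun i => f i.succ) (fun x => P (x + 1)) (fun x => d₀ x.succ)
      (fun x => d₁ x.succ) (fun x s hx => by simpa using h x.succ s (by simpa using hx)) _ h₁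
    refine ⟨s₂, h₃, (h₂.append h₄).congr ?_ rfl ?_ ?_⟩ <;> simp [_root_.encFin, List.ofFn_succ]

@[simp] theorem text_put (L : ℕ) (ptr : Ptr → ℕ) (b : Bool) (t : Token) :
    (Cmd.put b t : Cmd k).text L ptr = [t] := rfl

theorem map_range_eq_ofFn {α : Type} (L : ℕ) (g : ℕ → α) :
    (List.range L).map g = List.ofFn fun i : Fin L => g i :=
  List.ext_getElem (by simp) (by simp)

theorem expVec_mk (L : ℕ) {c : ℕ} (G : List (ℕ × Fin c)) (i : Fin L) (j : Fin c)
    (h : (i : ℕ) * c + j < L * c) : expVec L G ⟨i * c + j, h⟩ =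
      (G.map fun g => if (i : ℕ) = g.1 ∧ j = g.2 then 1 else 0).sum := by
  have hd : ((i : ℕ) * c + j) / c = i := by
    rw [Nat.mul_comm, Nat.mul_add_div j.pos, Nat.div_eq_of_lt j.isLt, Nat.add_zero]
  have hm : (⟨i * c + j, h⟩ : Fin (L * c)).modNat = j := by
    ext
    simp [Fin.modNat, Nat.mod_eq_of_lt j.isLt]
  simp only [expVec, Fin.coe_divNat, hd, hm]

/-- Slot `j` of cell `i` is variable number `i * c + j` with `c = k + k + 1`, so going through the
ruler cell by cell lists the exponents in the order of the variables. -/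
theorem text_vec (L : ℕ) (b : Bool) (e : PowerProduct k) (ptr : Ptr → ℕ) :
    (Cmd.vec b e).text L ptr =
      encFin encNat (expVec L (e.factors.map fun g => (ptr g.1, g.2))) := by
  simp only [Cmd.text, Cmd.cellOut, encFin, List.ofFn_mul, List.flatMap_def, List.map_flatten,
    List.flatten_flatten, List.map_ofFn]
  rw [map_range_eq_ofFn]
  congr 2
  funext i
  simp only [Function.comp_apply, List.map_ofFn]
  congr 2
  funext j
  simp only [Function.comp_apply]
  rw [expVec_mk]
  simp [PowerProduct.cellExponent, cellAt, Function.comp_def]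

theorem text_ex (L : ℕ) (ptr : Ptr → ℕ) :
    (Cmd.ex : Cmd k).text L ptr = List.replicate (L * (k + k + 1)) Token.ex := by
  simp only [Cmd.text, Cmd.cellOut]
  induction L with
  | zero => simp
  | succ L ih =>
    rw [List.range_succ, List.flatMap_append, ih, Nat.succ_mul, List.flatMap_singleton,
      List.replicate_append_replicate]

/-- The string of an equation, preceded by a conjunction symbol. -/
def eqText {N : ℕ} (p : SparsePoly N) : List Token := Token.conj :: Token.eqZero :: encPoly p

/-- The string of the monomials of a polynomial. -/
def monomialsText {N : ℕ} (p : SparsePoly N) : List Token :=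
  p.flatMap fun c => Token.monomial :: encMonomial c

theorem encInt_one : encInt 1 = [Token.bit true, Token.endNum] := rfl

theorem encInt_neg_one : encInt (-1) = [Token.minus, Token.bit true, Token.endNum] := rfl

theorem encInt_natCast (n : ℕ) : encInt n = bitsNat n ++ [Token.endNum] := by
  simp [encInt, encSign]

theorem cmdsPtr_prodCmds (ptr : Ptr → ℕ) : cmdsPtr ptr (prodCmds k) = ptr := by
  unfold prodCmds
  induction List.finRange k with
  | nil => rfl
  | cons t ts ih => simpa [cmdsPtr, Cmd.movePtr] using ih

theorem cmdsText_prodCmds_false (L : ℕ) (ptr : Ptr → ℕ) :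
    cmdsText L false ptr (prodCmds k) = [] := by
  unfold prodCmds
  induction List.finRange k with
  | nil => rfl
  | cons t ts ih => simpa [cmdsText, Cmd.movePtr, Cmd.target] using ih

theorem cmdsText_prodCmds_true (L : ℕ) (ptr : Ptr → ℕ) : cmdsText L true ptr (prodCmds k) =
    monomialsText (prodMonomials k L (ptr .row) (ptr .col) (ptr .pos)) := by
  unfold prodCmds prodMonomials monomialsText
  induction List.finRange k with
  | nil => rfl
  | cons t ts ih =>
    rw [List.flatMap_cons, List.map_cons, List.flatMap_cons, ← ih]
    simp [cmdsText, Cmd.movePtr, Cmd.target, text_vec, PowerProduct.factors, encMonomial,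
      encInt_one]

theorem reads_map_bit {m : Mode} (L : ℕ) (ptr : Ptr → ℕ)
    (h : ∀ a, transduce k m (.bit a) = (m, [.put false (.bit a)])) (l : List Bool) :
    Reads k L (m, ptr) (l.map Token.bit) (m, ptr) (l.map Token.bit) [] := by
  induction l with
  | nil => exact Reads.nil L _
  | cons a l ih => exact (Reads.cons (h a) ih).congr rfl rfl rfl rfl

theorem reads_bits {m : Mode} (L : ℕ) (ptr : Ptr → ℕ)
    (h : ∀ a, transduce k m (.bit a) = (m, [.put false (.bit a)])) (n : ℕ) :
    Reads k L (m, ptr) (bitsNat n) (m, ptr) (bitsNat n) [] := by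
  unfold bitsNat
  exact reads_map_bit L ptr h _

theorem reads_encNat_header {m m' : Mode} (L : ℕ) (ptr : Ptr → ℕ)
    (h : ∀ a, transduce k m (.bit a) = (m, [])) (h' : transduce k m .endNum = (m', [])) (n : ℕ) :
    Reads k L (m, ptr) (encNat n) (m', ptr) [] [] := by
  unfold encNat bitsNat
  induction Computability.encodeNat n with
  | nil => exact Reads.single h'
  | cons a l ih => exact Reads.cons (h a) ih

theorem cmdsPtr_openCmds (ptr : Ptr → ℕ) : cmdsPtr ptr (openCmds k) = ptr := rfl

theorem cmdsText_slashCmds (L : ℕ) (ptr : Ptr → ℕ) : cmdsText L false ptr (slashCmds k) =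
    Token.endNum :: encFin encNat (expVec L ([] : List (ℕ × Fin (k + k + 1)))) ++
      [Token.monomial] := by
  simp [slashCmds, cmdsText, Cmd.target, text_vec, PowerProduct.factors, Cmd.movePtr]

/-- The numerator becomes the coefficient of the constant monomial. The second monomial is left open
after its marker, since the digits of the denominator will be its coefficient. -/
theorem reads_numerator (L : ℕ) (r : Bool) (ptr : Ptr → ℕ) (z : ℤ) :
    Reads k L (.fresh r, ptr) (encSign z ++ bitsNat z.natAbs ++ [Token.slash]) (.den r, ptr)
      ([Token.conj, Token.eqZero, Token.monomial] ++ encInt z ++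
        encFin encNat (expVec L ([] : List (ℕ × Fin (k + k + 1)))) ++ [Token.monomial]) [] := by
  have hs : Reads k L (.num r, ptr) [Token.slash] (.den r, ptr)
      (cmdsText L false ptr (slashCmds k)) [] := Reads.single rfl
  have hb : ∀ a, transduce k (.num r) (.bit a) = (.num r, [.put false (.bit a)]) := fun _ => rfl
  unfold encInt encSign
  split_ifs with hz
  · refine (Reads.cons (t := .minus) (m' := .num r) (cs := openCmds k ++ [.put false .minus]) rfl
      ((reads_bits L ptr hb z.natAbs).append hs)).congr ?_ rfl ?_ ?_
    · simp
    · simp [cmdsText_slashCmds, openCmds, cmdsText, Cmd.target]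
    · rfl
  · unfold bitsNat
    cases Computability.encodeNat z.natAbs with
    -- The numerator is 0: the slash alone both opens and closes it.
    | nil =>
      refine (Reads.single (t := .slash) (m' := .den r) (cs := openCmds k ++ slashCmds k) rfl).congr
        ?_ rfl ?_ ?_
      · rfl
      · rw [cmdsText_append, cmdsPtr_openCmds, cmdsText_slashCmds]
        simp [openCmds, cmdsText, Cmd.target]
      · rfl
    | cons a l =>
      refine (Reads.cons (t := .bit a) (m' := .num r)
        (cs := openCmds k ++ [.put false (.bit a)]) rfl 
          ((reads_map_bit L ptr hb l).append hs)).congr ?_ rfl ?_ ?_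
      · simp
      · simp [cmdsText_slashCmds, openCmds, cmdsText, Cmd.target]
      · rfl

end Text

/-! ### Reading rationals, rows, constraints and whole instances -/

section Text

variable {k : ℕ}

@[simp] theorem text_inc (L : ℕ) (ptr : Ptr → ℕ) (a : Ptr) :
    (Cmd.inc a : Cmd k).text L ptr = [] := by
  simp [Cmd.text, Cmd.cellOut]

@[simp] theorem text_reset (L : ℕ) (ptr : Ptr → ℕ) (a : Ptr) :
    (Cmd.reset a : Cmd k).text L ptr = [] := by
  simp [Cmd.text, Cmd.cellOut]

/-- Matrix entries and right-hand sides differ only in the commands at their end; the two hypotheses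
isolate what these must write. -/
theorem reads_encRat {L : ℕ} {r : Bool} {ptr : Ptr → ℕ} {e₁ : List Token} (q : ℚ)
    (h₀ : cmdsText L false ptr (endCmds k r) = Token.endNum ::
      encFin encNat (expVec L [(ptr .pos, slotR k)]) ++ [Token.endPoly])
    (h₁ : cmdsText L true ptr (endCmds k r) = e₁) :
    Reads k L (.fresh r, ptr) (encRat q) (.fresh r, cmdsPtr ptr (endCmds k r))
      (eqText (ratPoly k L (ptr .pos) q)) e₁ := by
  have hd : Reads k L (.den r, ptr) [Token.endNum] (.fresh r, cmdsPtr ptr (endCmds k r)) _ e₁ :=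
    (Reads.single rfl).congr rfl rfl h₀ h₁
  refine (((reads_numerator L r ptr q.num).append (reads_bits L ptr (fun _ => rfl) q.den)).append
    hd).congr ?_ rfl ?_ rfl
  · simp [encRat]
  · simp [eqText, encPoly, ratPoly, encMonomial, encInt_natCast]

theorem reads_entry (L : ℕ) (ptr : Ptr → ℕ) (q : ℚ) :
    Reads k L (.fresh false, ptr) (encRat q) (.fresh false, cmdsPtr ptr (endCmds k false))
      (eqText (ratPoly k L (ptr .pos) q))
      (monomialsText (prodMonomials k L (ptr .row) (ptr .col) (ptr .pos))) := by
  have hp : cmdsPtr ptr ([.put false .endNum, .vec false .rat, .put false .endPoly] :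
      List (Cmd k)) = ptr := rfl
  refine reads_encRat q ?_ ?_
  · rw [endCmds, cmdsText_append, cmdsText_append, hp, cmdsText_prodCmds_false]
    simp [cmdsText, Cmd.target, Cmd.movePtr, text_vec, PowerProduct.factors]
  · rw [endCmds, cmdsText_append, cmdsText_append, hp, cmdsText_prodCmds_true]
    simp [cmdsText, Cmd.target]

theorem cmdsPtr_endCmds_false (ptr : Ptr → ℕ) : cmdsPtr ptr (endCmds k false) =
    Function.update (Function.update ptr .col (ptr .col + 1)) .pos (ptr .pos + 1) := by
  rw [endCmds, cmdsPtr_append, cmdsPtr_append, cmdsPtr_prodCmds]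
  rfl

theorem reads_rhs (L : ℕ) (ptr : Ptr → ℕ) (q : ℚ) :
    Reads k L (.fresh true, ptr) (encRat q)
      (.fresh true, Function.update ptr .pos (ptr .pos + 1)) (eqText (ratPoly k L (ptr .pos) q))
      (monomialsText (N := L * (k + k + 1)) [(-1, expVec L [(ptr .pos, slotR k)])] ++
        [Token.endPoly]) := by
  refine reads_encRat q ?_ ?_
  · simp [endCmds, cmdsText, Cmd.target, Cmd.movePtr, text_vec, PowerProduct.factors]
  · simp [endCmds, cmdsText, Cmd.target, Cmd.movePtr, text_vec, PowerProduct.factors,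
      monomialsText, encMonomial, encInt_neg_one]

/-- The row marker comes before the entries, so these are read with the row counter already at `i +
1`. -/
theorem reads_encRow (L i p n : ℕ) (a : Fin n → ℚ) (s : Mode × (Ptr → ℕ))
    (hs : s.1 = .fresh false ∧ s.2 .row = i ∧ s.2 .pos = p) :
    ∃ s' : Mode × (Ptr → ℕ), (s'.1 = .fresh false ∧ s'.2 .row = i + 1 ∧ s'.2 .pos = p + n) ∧
      Reads k L s (encRow a) s'
        (List.ofFn fun j : Fin n => eqText (ratPoly k L (p + j) (a j))).flatten
        (List.ofFn fun j : Fin n =>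
          monomialsText (prodMonomials k L (i + 1) j (p + j))).flatten := by
  obtain ⟨m, ptr⟩ := s
  obtain ⟨rfl, rfl, rfl⟩ := hs
  obtain ⟨s', ⟨h₁, h₂, -, h₃⟩, h⟩ := Reads.encFin (k := k) L encRat a
    (fun x s => s.1 = .fresh false ∧ s.2 .row = ptr .row + 1 ∧ s.2 .col = x ∧
      s.2 .pos = ptr .pos + x)
    (fun j => eqText (ratPoly k L (ptr .pos + j) (a j)))
    (fun j => monomialsText (prodMonomials k L (ptr .row + 1) j (ptr .pos + j))) (by
      rintro x ⟨m, ptr'⟩ ⟨rfl, h₁, h₂, h₃⟩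
      dsimp only at h₁ h₂ h₃
      refine ⟨_, ?_, (reads_entry L ptr' (a x)).congr rfl rfl ?_ ?_⟩
      · rw [cmdsPtr_endCmds_false]
        simp [h₁, h₂, h₃, Nat.add_assoc]
      · rw [h₃]
      · rw [h₁, h₂, h₃])
    (.fresh false, cmdsPtr ptr ([.inc .row, .reset .col] : List (Cmd k)))
    (by simp [cmdsPtr, Cmd.movePtr])
  exact ⟨s', ⟨h₁, h₂, h₃⟩, (Reads.cons rfl h).congr rfl rfl (by simp [cmdsText, Cmd.target])
    (by simp [cmdsText, Cmd.target])⟩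

theorem monomialsText_append {N : ℕ} (p p' : SparsePoly N) :
    monomialsText (p ++ p') = monomialsText p ++ monomialsText p' := List.flatMap_append

theorem monomialsText_flatten {N : ℕ} (ps : List (SparsePoly N)) :
    monomialsText ps.flatten = (ps.map monomialsText).flatten := by
  induction ps with
  | nil => rfl
  | cons p ps ih => rw [List.flatten_cons, monomialsText_append, ih]; rfl

theorem encPoly_eq {N : ℕ} (p : SparsePoly N) :
    encPoly p = monomialsText p ++ [Token.endPoly] := rfl

/-- A constraint contains `m * n + 1` rationals, which is the advance of `pos`. The flag of the mode
and the row counter may be arbitrary at the start, as the marker of the matrix resets both. -/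
theorem reads_encConstraint (L p m n : ℕ) (c : (Fin m → Fin n → ℚ) × ℚ) (s : Mode × (Ptr → ℕ))
    (hs : (∃ r, s.1 = .fresh r) ∧ s.2 .pos = p) :
    ∃ s' : Mode × (Ptr → ℕ), ((∃ r, s'.1 = .fresh r) ∧ s'.2 .pos = p + (m * n + 1)) ∧
      Reads k L s (encConstraint c) s' ((ratPolys k L p c).flatMap eqText)
        (eqText (constraintPoly k L m n p)) := by
  obtain ⟨md, ptr⟩ := s
  obtain ⟨⟨r, rfl⟩, rfl⟩ := hs
  obtain ⟨⟨_, ptr'⟩, ⟨rfl, h₁, h₂⟩, h⟩ := Reads.encFin (k := k) L encRow c.1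
    (fun x s => s.1 = .fresh false ∧ s.2 .row = x ∧ s.2 .pos = ptr .pos + x * n)
    (fun i => (List.ofFn fun j : Fin n =>
      eqText (ratPoly k L (ptr .pos + i * n + j) (c.1 i j))).flatten)
    (fun i => (List.ofFn fun j : Fin n => monomialsText
      (prodMonomials k L (i + 1) j (ptr .pos + i * n + j))).flatten) (by
      intro x s hs
      obtain ⟨s', h, h'⟩ := reads_encRow L x (ptr .pos + x * n) n (c.1 x) s hs
      exact ⟨s', by rwa [Nat.succ_mul, ← Nat.add_assoc], h'⟩)
    (.fresh false, cmdsPtr ptr ([.put true .conj, .put true .eqZero, .reset .row] : List (Cmd k)))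
    (by simp [cmdsPtr, Cmd.movePtr])
  dsimp only at h₂
  have hr : Reads k L (.fresh false, ptr') (Token.rhs :: encRat c.2) _ _ _ :=
    Reads.cons (m' := .fresh true) (cs := []) rfl (reads_rhs L ptr' c.2)
  rw [h₂] at hr
  refine ⟨_, ?_, (Reads.cons rfl (h.append hr)).congr rfl rfl ?_ ?_⟩
  · simp [Nat.add_assoc]
  · simp [cmdsText, Cmd.target, ratPolys, List.flatMap_def, List.map_flatten,
      List.map_ofFn, Function.comp_def]
    simp [List.flatten_flatten, List.map_ofFn, Function.comp_def]
  · simp [cmdsText, Cmd.target, constraintPoly, eqText]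
    rw [encPoly_eq, monomialsText_append, monomialsText_flatten]
    simp [monomialsText_flatten, List.map_ofFn, Function.comp_def]

theorem reads_encode (L : ℕ) (ptr : Ptr → ℕ) (I : ARMInstance) (hp : ptr .pos = 0) :
    ∃ s', Reads k L (.header 0, ptr) I.encode s' ((I.ratPolys k L).flatMap eqText)
      ((I.constraintPolys k L).flatMap eqText) := by
  obtain ⟨s', -, h⟩ := Reads.encFin (k := k) L encConstraint
    (fun l : Fin I.q => ((fun i j => I.A l i j), I.b l))
    (fun x s => (∃ r, s.1 = .fresh r) ∧ s.2 .pos = x * (I.m * I.n + 1))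
    (fun l => (ratPolys k L (l * (I.m * I.n + 1)) ((fun i j => I.A l i j), I.b l)).flatMap eqText)
    (fun l => eqText (constraintPoly k L I.m I.n (l * (I.m * I.n + 1)))) (by
      intro x s hs
      obtain ⟨s', h, h'⟩ := reads_encConstraint L _ I.m I.n
        ((fun i j => I.A x i j), I.b x) s hs
      exact ⟨s', by rwa [Nat.succ_mul], h'⟩)
    (.fresh false, ptr) ⟨⟨false, rfl⟩, by simpa using hp⟩
  refine ⟨s', ((((reads_encNat_header L ptr (fun _ => rfl) rfl I.m).append
    (reads_encNat_header L ptr (fun _ => rfl) rfl I.n)).append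
    (reads_encNat_header L ptr (fun _ => rfl) rfl I.q)).append h).congr rfl rfl ?_ ?_⟩
  · simp [ARMInstance.ratPolys, List.flatMap_def, List.map_flatten, List.flatten_flatten,
      List.map_ofFn, Function.comp_def]
  · simp [ARMInstance.constraintPolys, List.flatMap_def, List.map_ofFn, Function.comp_def]

/-- Only `pos` has to start at 0; row and column counters are reset by the markers before they are
used. -/
theorem encode_toETR (I : ARMInstance) : (I.toETR k).encode = reductionText k I.encode := by
  have h₁ : execAll I.encode.length ⟨fun _ => I.encode.length, fun _ => []⟩ (startCmds k) =
      ⟨Function.update (fun _ => I.encode.length) .pos 0,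
        fun b => if b then [] else
          List.replicate (I.encode.length * (k + k + 1)) Token.ex⟩ := by
    rw [execAll_eq]
    simp only [Work.mk.injEq]
    refine ⟨rfl, funext fun b => ?_⟩
    cases b <;> simp [startCmds, cmdsText, Cmd.target, text_ex]
  obtain ⟨s', -, h₂, h₃⟩ := reads_encode (k := k) I.encode.length
    (Function.update (fun _ => I.encode.length) .pos 0) I (by simp)
  simp only [ETRSentence.encode, ARMInstance.toETR, encode_conjAll, reductionText, startWork,
    readAll_eq, h₁, h₂, h₃]
  simp only [List.flatMap_append, List.append_assoc, if_true, List.nil_append, Bool.false_eq_true,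
    if_false]
  rfl

end Text

/-! ### Rank factorization -/

/-- The range of `X` has dimension at most `k`, so it embeds into `Fin k → K` by some `f` with a
left inverse `g`. Inserting `g ∘ f` between the corestriction of `X` to its range and the inclusion
of the range gives the two factors. -/
theorem Matrix.rank_le_iff_exists_mul {K : Type*} [Field K] {m n : ℕ} (k : ℕ)
    (X : Matrix (Fin m) (Fin n) K) :
    X.rank ≤ k ↔ ∃ (U : Matrix (Fin m) (Fin k) K) (V : Matrix (Fin k) (Fin n) K), X = U * V := by
  constructor
  · intro h
    have hW : Module.finrank K (LinearMap.range X.mulVecLin) ≤ Module.finrank K (Fin k → K) := by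
      simpa [Matrix.rank] using h
    obtain ⟨f, hf⟩ := finrank_le_iff_exists_linearMap.1 hW
    obtain ⟨g, hg⟩ := f.exists_leftInverse_of_injective (LinearMap.ker_eq_bot.2 hf)
    refine ⟨LinearMap.toMatrix' ((LinearMap.range X.mulVecLin).subtype ∘ₗ g),
      LinearMap.toMatrix' (f ∘ₗ X.mulVecLin.rangeRestrict), ?_⟩
    have hX : (LinearMap.range X.mulVecLin).subtype ∘ₗ X.mulVecLin.rangeRestrict =
        X.mulVecLin := LinearMap.ext fun _ => rfl
    rw [← LinearMap.toMatrix'_comp, LinearMap.comp_assoc, ← LinearMap.comp_assoc _ f g, hg,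
      LinearMap.id_comp, hX, ← Matrix.toLin'_apply',
      LinearMap.toMatrix'_toLin']
  · rintro ⟨U, V, rfl⟩
    exact (Matrix.rank_mul_le_left U V).trans ((Matrix.rank_le_card_width U).trans (by simp))

theorem feasible_iff_exists_mul (k : ℕ) (I : ARMInstance) : I.Feasible k ↔
    ∃ (U : Matrix (Fin I.m) (Fin k) ℝ) (V : Matrix (Fin k) (Fin I.n) ℝ),
      ∀ l, frobeniusInner (I.A l) (U * V) = I.b l := by
  constructor
  · rintro ⟨X, hX, hr⟩
    obtain ⟨U, V, rfl⟩ := (Matrix.rank_le_iff_exists_mul k X).1 hr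
    exact ⟨U, V, hX⟩
  · rintro ⟨U, V, h⟩
    exact ⟨U * V, h, (Matrix.rank_le_iff_exists_mul k _).2 ⟨U, V, rfl⟩⟩

/-! ### Values of the polynomials -/

section Eval

theorem entry_index_lt {m n : ℕ} (i : Fin m) (j : Fin n) : (i : ℕ) * n + j < m * n := by
  have := Nat.mul_le_mul_right n (Nat.succ_le_of_lt i.isLt)
  rw [Nat.succ_mul] at this
  omega

/-- The value of the variable in the given cell and slot. -/
noncomputable def cellVal {L c : ℕ} (x : Fin (L * c) → ℝ) (i : ℕ) (s : Fin c) : ℝ :=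
  if h : i < L then x (finProdFinEquiv (⟨i, h⟩, s)) else 0

/-- The bound on the cells matters: a variable beyond the last cell would contribute no exponent,
hence a factor 1, whereas `cellVal` is 0 there. -/
theorem prod_pow_expVec {L c : ℕ} (x : Fin (L * c) → ℝ) (G : List (ℕ × Fin c))
    (hG : ∀ g ∈ G, g.1 < L) :
    ∏ v, x v ^ expVec L G v = (G.map fun g => cellVal x g.1 g.2).prod := by
  induction G with
  | nil => simp [expVec]
  | cons g G ih =>
    have hg : g.1 < L := hG g (by simp)
    have e : ∀ v, expVec L (g :: G) v =
        (if v = finProdFinEquiv (⟨g.1, hg⟩, g.2) then 1 else 0) + expVec L G v := by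
      intro v
      have : v = finProdFinEquiv (⟨g.1, hg⟩, g.2) ↔ (v.divNat : ℕ) = g.1 ∧ v.modNat = g.2 := by
        rw [← Equiv.symm_apply_eq, Prod.ext_iff, Fin.ext_iff]
        rfl
      simp only [expVec, this, List.map_cons, List.sum_cons]
    simp only [e, pow_add, Finset.prod_mul_distrib, List.map_cons, List.prod_cons]
    rw [ih fun g' hg' => hG g' (by simp [hg'])]
    congr 1
    simp [cellVal, hg, pow_ite, Finset.prod_ite_eq']

theorem SparsePoly.eval_append {N : ℕ} (p p' : SparsePoly N) (x : Fin N → ℝ) :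
    SparsePoly.eval (p ++ p') x = p.eval x + p'.eval x := by
  simp [SparsePoly.eval]

theorem SparsePoly.eval_flatten {N : ℕ} (ps : List (SparsePoly N)) (x : Fin N → ℝ) :
    SparsePoly.eval ps.flatten x = (ps.map fun p => p.eval x).sum := by
  induction ps with
  | nil => rfl
  | cons p ps ih => rw [List.flatten_cons, SparsePoly.eval_append, ih]; simp

variable {k L : ℕ} (x : Fin (L * (k + k + 1)) → ℝ)

theorem eval_ratPoly {p : ℕ} (hp : p < L) (r : ℚ) :
    (ratPoly k L p r).eval x = r.num + r.den * cellVal x p (slotR k) := by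
  simp [SparsePoly.eval, ratPoly, prod_pow_expVec, hp]

theorem eval_ratPoly_eq_zero {p : ℕ} (hp : p < L) (r : ℚ) :
    (ratPoly k L p r).eval x = 0 ↔ cellVal x p (slotR k) = -r := by
  rw [eval_ratPoly x hp]
  have hd : (r.den : ℝ) ≠ 0 := by exact_mod_cast r.den_ne_zero
  rw [Rat.cast_def, eq_neg_iff_add_eq_zero]
  constructor <;> intro h
  · field_simp
    linarith
  · field_simp at h
    linarith

theorem eval_prodMonomials {i j p : ℕ} (hi : i < L) (hj : j < L) (hp : p < L) :
    (prodMonomials k L i j p).eval x = cellVal x p (slotR k) *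
      ∑ t : Fin k, cellVal x i (slotU t) * cellVal x j (slotV t) := by
  have : ∀ t : Fin k, ∏ v, x v ^ expVec L [(i, slotU t), (j, slotV t), (p, slotR k)] v =
      cellVal x p (slotR k) * (cellVal x i (slotU t) * cellVal x j (slotV t)) := by
    intro t
    rw [prod_pow_expVec _ _ (by simp [hi, hj, hp])]
    simp
    ring
  simp only [SparsePoly.eval, prodMonomials, List.map_map, Function.comp_def, this]
  rw [← List.ofFn_eq_map, List.sum_ofFn, Finset.mul_sum]
  simp

/-- Rows use the cells 1 to `m`, hence the strict `m < L`; columns use 0 to `n - 1`. For `m = 0`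
there are no entries, and `n` may well exceed `L`. -/
theorem eval_constraintPoly {m n p : ℕ} (hp : p + m * n < L) (hm : m < L)
    (hn : m ≠ 0 → n ≤ L) : (constraintPoly k L m n p).eval x =
      (∑ i : Fin m, ∑ j : Fin n, cellVal x (p + i * n + j) (slotR k) *
        ∑ t : Fin k, cellVal x (i + 1) (slotU t) * cellVal x j (slotV t)) -
          cellVal x (p + m * n) (slotR k) := by
  rw [constraintPoly, SparsePoly.eval_append, SparsePoly.eval_flatten, List.map_ofFn,
    List.sum_ofFn, sub_eq_add_neg]
  congr 1
  · refine Finset.sum_congr rfl fun i _ => ?_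
    rw [Function.comp_apply, SparsePoly.eval_flatten, List.map_ofFn, List.sum_ofFn]
    refine Finset.sum_congr rfl fun j _ => ?_
    have hij := entry_index_lt i j
    rw [Function.comp_apply, eval_prodMonomials x (by omega)
      (j.isLt.trans_le (hn (by have := i.pos; omega))) (by omega)]
  · simp [SparsePoly.eval, prod_pow_expVec, hp]

end Eval

/-! ### Lengths of encodings -/

theorem length_encFin_ge {α : Type} (e : α → List Token) {n : ℕ} (f : Fin n → α) (c : ℕ)
    (h : ∀ a, c ≤ (e a).length) : n * c ≤ (encFin e f).length := by
  rw [encFin, List.length_flatMap, List.map_ofFn, List.sum_ofFn]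
  simpa using Finset.card_nsmul_le_sum Finset.univ (fun i => (e (f i)).length) c fun i _ => h _

/-- A row has a marker and at least one token per entry, and a constraint has two more markers. Thus
any constraint bounds the dimensions it uses by the input length, although they are announced in
binary. -/
theorem length_encode_ge (I : ARMInstance) :
    I.q * (I.m * (I.n + 1) + 2) ≤ I.encode.length := by
  have h₁ : ∀ r : ℚ, 1 ≤ (encRat r).length := fun r => by simp [encRat]; omega
  have h₂ : ∀ r : Fin I.n → ℚ, I.n + 1 ≤ (encRow r).length := fun r => by
    have := length_encFin_ge encRat r 1 h₁
    simp only [encRow, List.length_cons]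
    omega
  have h₃ : ∀ c : (Fin I.m → Fin I.n → ℚ) × ℚ,
      I.m * (I.n + 1) + 2 ≤ (encConstraint c).length := fun c => by
    have := length_encFin_ge encRow c.1 (I.n + 1) h₂
    simp only [encConstraint, List.length_cons, List.length_append]
    omega
  have := length_encFin_ge encConstraint (fun l : Fin I.q => ((fun i j => I.A l i j), I.b l)) _ h₃
  simp only [ARMInstance.encode, List.length_append]
  omega

/-! ### Correctness of the reduction -/

section Correctness

variable {k : ℕ} (I : ARMInstance)

theorem index_lt_length (l : Fin I.q) :
    l * (I.m * I.n + 1) + I.m * I.n < I.encode.length ∧ I.m < I.encode.length ∧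
      (I.m ≠ 0 → I.n ≤ I.encode.length) := by
  have h := length_encode_ge I
  have hl : (l + 1) * (I.m * (I.n + 1) + 2) ≤ I.q * (I.m * (I.n + 1) + 2) :=
    Nat.mul_le_mul_right _ l.isLt
  refine ⟨by nlinarith, ?_, fun hm => ?_⟩
  · have : I.m ≤ I.m * (I.n + 1) := Nat.le_mul_of_pos_right _ (Nat.succ_pos _)
    nlinarith
  have : I.n ≤ I.m * I.n := Nat.le_mul_of_pos_left _ (Nat.pos_of_ne_zero hm)
  nlinarith

theorem mem_ratPolys {L : ℕ} (p : SparsePoly (L * (k + k + 1))) : p ∈ I.ratPolys k L ↔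
    ∃ l : Fin I.q,
      (∃ (i : Fin I.m) (j : Fin I.n),
        ratPoly k L (l * (I.m * I.n + 1) + i * I.n + j) (I.A l i j) = p) ∨
      p = ratPoly k L (l * (I.m * I.n + 1) + I.m * I.n) (I.b l) := by
  simp [ARMInstance.ratPolys, ratPolys, List.mem_flatten, List.mem_ofFn]

/-- Once the `R` variables are fixed to the negated rationals, both parts of a constraint polynomial
change sign and its vanishing is the original constraint. -/
theorem toETR_isTrue_iff : (I.toETR k).IsTrue ↔
    ∃ x : Fin (I.encode.length * (k + k + 1)) → ℝ, ∀ l : Fin I.q,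
      (∀ (i : Fin I.m) (j : Fin I.n),
        cellVal x (l * (I.m * I.n + 1) + i * I.n + j) (slotR k) = -(I.A l i j : ℝ)) ∧
      cellVal x (l * (I.m * I.n + 1) + I.m * I.n) (slotR k) = -(I.b l : ℝ) ∧
      ∑ i : Fin I.m, ∑ j : Fin I.n, (I.A l i j : ℝ) *
        ∑ t : Fin k, cellVal x (i + 1) (slotU t) * cellVal x j (slotV t) = I.b l := by
  refine exists_congr fun x => ?_
  have key : ∀ l : Fin I.q,
      (∀ (i : Fin I.m) (j : Fin I.n),
        cellVal x (l * (I.m * I.n + 1) + i * I.n + j) (slotR k) = -(I.A l i j : ℝ)) →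
      cellVal x (l * (I.m * I.n + 1) + I.m * I.n) (slotR k) = -(I.b l : ℝ) →
      ((constraintPoly k I.encode.length I.m I.n (l * (I.m * I.n + 1))).eval x = 0 ↔
        ∑ i : Fin I.m, ∑ j : Fin I.n, (I.A l i j : ℝ) *
          ∑ t : Fin k, cellVal x (i + 1) (slotU t) * cellVal x j (slotV t) = I.b l) := by
    intro l h₁ h₂
    obtain ⟨hl, hm, hn⟩ := index_lt_length I l
    rw [eval_constraintPoly x hl hm hn, h₂]
    simp only [h₁, neg_mul, Finset.sum_neg_distrib]
    rw [sub_neg_eq_add, neg_add_eq_zero]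
  refine (sat_conjAll _ x).trans ?_
  constructor
  · intro h l
    have h₁ : ∀ (i : Fin I.m) (j : Fin I.n),
        cellVal x (l * (I.m * I.n + 1) + i * I.n + j) (slotR k) = -(I.A l i j : ℝ) := fun i j =>
      (eval_ratPoly_eq_zero x (by
        have := entry_index_lt i j
        have := (index_lt_length I l).1
        omega) _).1
        (h _ (List.mem_append_left _ ((mem_ratPolys I _).2 ⟨l, .inl ⟨i, j, rfl⟩⟩)))
    have h₂ := (eval_ratPoly_eq_zero x (index_lt_length I l).1 _).1
      (h _ (List.mem_append_left _ ((mem_ratPolys I _).2 ⟨l, .inr rfl⟩)))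
    exact ⟨h₁, h₂, (key l h₁ h₂).1
      (h _ (List.mem_append_right _ (List.mem_ofFn.2 ⟨l, rfl⟩)))⟩
  · intro h p hp
    rcases List.mem_append.1 hp with hp | hp
    · obtain ⟨l, ⟨i, j, rfl⟩ | rfl⟩ := (mem_ratPolys I _).1 hp
      · refine (eval_ratPoly_eq_zero x ?_ _).2 ((h l).1 i j)
        have := entry_index_lt i j
        have := (index_lt_length I l).1
        omega
      · exact (eval_ratPoly_eq_zero x (index_lt_length I l).1 _).2 (h l).2.1
    · obtain ⟨l, rfl⟩ := List.mem_ofFn.1 hp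
      exact (key l (h l).1 (h l).2.1).2 (h l).2.2

/-- Indices are numbers in mixed radix: the quotient by `m * n + 1` is the constraint, and the
remainder is `i * n + j` for an entry and `m * n` for the right-hand side. So all values can be
prescribed independently. -/
theorem exists_extension_of_index {q m n : ℕ} (A : Fin q → Fin m → Fin n → ℝ) (b : Fin q → ℝ) :
    ∃ R : ℕ → ℝ, ∀ l : Fin q,
      (∀ (i : Fin m) (j : Fin n), R (l * (m * n + 1) + i * n + j) = A l i j) ∧
        R (l * (m * n + 1) + m * n) = b l := by
  have hdiv : ∀ l r : ℕ, r < m * n + 1 → (l * (m * n + 1) + r) / (m * n + 1) = l := by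
    intro l r hr
    rw [Nat.mul_comm, Nat.mul_add_div (Nat.succ_pos _), Nat.div_eq_of_lt hr, Nat.add_zero]
  have hmod : ∀ l r : ℕ, r < m * n + 1 → (l * (m * n + 1) + r) % (m * n + 1) = r := by
    intro l r hr
    rw [Nat.mul_comm, Nat.mul_add_mod, Nat.mod_eq_of_lt hr]
  refine ⟨fun a => if h : a / (m * n + 1) < q then
      if h' : a % (m * n + 1) / n < m ∧ a % (m * n + 1) % n < n then
        A ⟨_, h⟩ ⟨_, h'.1⟩ ⟨_, h'.2⟩ else b ⟨_, h⟩ else 0, fun l => ⟨fun i j => ?_, ?_⟩⟩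
  · have hr : (i : ℕ) * n + j < m * n + 1 := (entry_index_lt i j).trans (Nat.lt_succ_self _)
    have hi : ((i : ℕ) * n + j) / n = i := by
      rw [Nat.mul_comm, Nat.mul_add_div j.pos, Nat.div_eq_of_lt j.isLt, Nat.add_zero]
    have hj : ((i : ℕ) * n + j) % n = j := by
      rw [Nat.mul_comm, Nat.mul_add_mod, Nat.mod_eq_of_lt j.isLt]
    simp only [Nat.add_assoc, hdiv _ _ hr, hmod _ _ hr, hi, hj, Fin.is_lt, and_self, dite_true]
  · have hr : m * n < m * n + 1 := Nat.lt_succ_self _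
    -- The remainder `m * n` fails the test for an entry: its quotient by `n` is `m` if `n > 0`, and
    -- nothing is below `n` if `n = 0`.
    have h : ¬(m * n / n < m ∧ m * n % n < n) := by
      rintro ⟨h₁, h₂⟩
      rw [Nat.mul_div_cancel _ (by omega)] at h₁
      exact lt_irrefl _ h₁
    simp only [hdiv _ _ hr, hmod _ _ hr, Fin.is_lt, dite_true, dif_neg h]

theorem cellVal_of_lt {L c : ℕ} (y : ℕ → Fin c → ℝ) {i : ℕ} (hi : i < L) (s : Fin c) :
    cellVal (L := L) (fun v => y (finProdFinEquiv.symm v).1 (finProdFinEquiv.symm v).2) i s =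
      y i s := by
  simp only [cellVal, hi, dite_true, Equiv.symm_apply_apply]

theorem isTrue_toETR_iff : (I.toETR k).IsTrue ↔ I.Feasible k := by
  rw [toETR_isTrue_iff, feasible_iff_exists_mul]
  constructor
  · rintro ⟨x, hx⟩
    refine ⟨.of fun i t => cellVal x (i + 1) (slotU t),
      .of fun t j => cellVal x j (slotV t), fun l => ?_⟩
    simpa only [frobeniusInner, Matrix.mul_apply, Matrix.of_apply] using (hx l).2.2
  · rintro ⟨U, V, h⟩
    obtain ⟨R, hR⟩ := exists_extension_of_index (fun l i j => -(I.A l i j : ℝ))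
      (fun l => -(I.b l : ℝ))
    -- Row `i` lives in cell `i + 1`, hence `a - 1`; the value in the `U` slots of cell 0 is
    -- irrelevant. The slots below `k` belong to `U`, the next `k` to `V`, and the last one to `R`.
    let y : ℕ → Fin (k + k + 1) → ℝ := fun a s =>
      if hs : (s : ℕ) < k then if ha : a - 1 < I.m then U ⟨a - 1, ha⟩ ⟨s, hs⟩ else 0
      else if hs : (s : ℕ) - k < k then if ha : a < I.n then V ⟨s - k, hs⟩ ⟨a, ha⟩ else 0
      else R a
    have hU : ∀ (i : Fin I.m) (t : Fin k), y (i + 1) (slotU t) = U i t := by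
      intro i t; simp [y, slotU]
    have hV : ∀ (j : Fin I.n) (t : Fin k), y j (slotV t) = V t j := by
      intro j t; simp [y, slotV]
    have hy : ∀ a, y a (slotR k) = R a := by
      intro a; simp [y, slotR]
    refine ⟨fun v => y (finProdFinEquiv.symm v).1 (finProdFinEquiv.symm v).2, fun l => ?_⟩
    obtain ⟨hl, hm, hn⟩ := index_lt_length I l
    refine ⟨fun i j => ?_, ?_, ?_⟩
    · have := entry_index_lt i j
      rw [cellVal_of_lt y (by omega), hy, (hR l).1]
    · rw [cellVal_of_lt y hl, hy, (hR l).2]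
    · rw [← h l]
      simp only [frobeniusInner, Matrix.mul_apply]
      refine Finset.sum_congr rfl fun i _ => Finset.sum_congr rfl fun j _ => ?_
      have hi := i.isLt
      have hj := hn (by omega)
      congr 1
      refine Finset.sum_congr rfl fun t _ => ?_
      rw [cellVal_of_lt y (by omega), cellVal_of_lt y (by omega), hU, hV]

end Correctness

theorem mainTheorem2 (k : ℕ) (hk : 1 ≤ k) :
    ARM k ∈ ExistsR ∧
      ∀ I : ARMInstance, I.Feasible k ↔
        ∃ (U : Matrix (Fin I.m) (Fin k) ℝ) (V : Matrix (Fin k) (Fin I.n) ℝ),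
          ∀ l, frobeniusInner (I.A l) (U * V) = I.b l := by
  refine ⟨⟨fun I => I.toETR k, computableInPolyTime_of_reductionText (k := k) _ _ _ encode_toETR,
    fun I => (isTrue_toETR_iff I).symm⟩, feasible_iff_exists_mul k⟩
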